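/- Let $\Bbbk$ be an algebraically closed field. For $i,j\in\mathbb N$, an $(i,j)$-Brauer diagram is a partition into pairs of a set of $i+j$ dots, $i$ of them on a lower horizontal line and $j$ on an upper one, drawn as lines joining the dots of each pair. Lines joining two lower dots are called caps, lines joining two upper dots are called cups. The periplectic Brauer category $\mathcal A$ is the $\Bbbk$-linear category with object set $\mathbb N$ in which $\mathrm{Hom}_{\mathcal A}(i,j)$ is the $\Bbbk$-vector space with basis the $(i,j)$-Brauer diagrams. The composition of a $(j,k)$-diagram $d_1$ with an $(i,j)$-diagram $d_2$ is obtained by placing $d_1$ on top of $d_2$: if this creates a closed loop then $d_1\circ d_2=0$, and otherwise $d_1\circ d_2=(-1)^{\gamma(d_1,d_2)}\,d_1\ast d_2$, where $d_1\ast d_2$ is the concatenated diagram and $\gamma(d_1,d_2)$ is the following number. In the standard marking of a diagram, every cup carries a diamond and every cap an arrow pointing to the right, all markings lying at different heights; all diamonds are higher than all arrows; a diamond is higher than another one if the left-most dot of its cup is more to the left; an arrow is higher than another one if the left-most dot of its cap is more to the right. Give $d_1$ and $d_2$ their standard markings and transform the resulting decoration of $d_1\ast d_2$ into the standard marking of $d_1\ast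 d_2$ by (i) exchanging two markings of neighbouring heights, (ii) cancelling an arrow and a diamond that are consecutive on the same line and of neighbouring heights (the arrow above the diamond), and (iii) reversing an arrow. Then $\gamma(d_1,d_2)$ is the number of operations (i) and (iii) used, plus the number of operations (ii) in which the arrow pointed away from the diamond; its parity does not depend on the choices. For $n\ge 2$ put $\mathscr J(n)=\{n-2i\mid 0\le i\le n/2\}$ and $$A_n=\mathrm{End}_{\mathcal A}(n),\qquad C_n=\bigoplus_{i,j\in\mathscr J(n)}\mathrm{Hom}_{\mathcal A}(i,j),$$ with product given by composition (non-composable morphisms having product $0$). Let $e_n^\ast\in C_n$ be the identity morphism of the object $n$, so that $A_n=e_n^\ast C_ne_n^\ast$, and let $X=e_n^\ast C_n$, regarded as an $(A_n,C_n)$-bimodule by left and right multiplication. **Theorem (double centralisers).** If $n>2$, then the canonical maps given by the two actions on $X$ are isomorphisms of $\Bbbk$-algebras $$A_n\;\xrightarrow{\ \sim\ }\;\mathrm{End}_{C_n}(X),\quad a\mapsto (x\mapsto ax),\qquad\text{and}\qquad C_n\;\xrightarrow{\ \sim\ }\;\mathrm{End}_{A_n}(X)^{\mathrm{op}},\quad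 c\mapsto (x\mapsto xc),$$ where $\mathrm{End}_{C_n}(X)$ consists of the endomorphisms of the right $C_n$-module $X$ and $\mathrm{End}_{A_n}(X)$ of those of the left $A_n$-module $X$. -/

import Mathlib

/-!
The periplectic Brauer category over a field, the algebras `A n` and `C n` and the bimodule `X n`.

Contents: Brauer diagrams and their concatenation; the sign of a concatenation; proofs that the
signed concatenation is associative and unital; the category and the algebras.
-/

namespace PeriplecticBrauer

open CategoryTheory

universe u


/-! ### Brauer diagrams -/

/-- An `(i, j)`-Brauer diagram: a partition into pairs of the `i` lower dots (left summand) and the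
`j` upper dots (right summand), given by the involution that sends a dot to its partner. Dots are
numbered from left to right. -/
@[ext]
structure Diagram (i j : ℕ) where
  pair : Fin i ⊕ Fin j → Fin i ⊕ Fin j
  pair_pair : ∀ x, pair (pair x) = x
  pair_ne : ∀ x, pair x ≠ x

variable {i j k l m n : ℕ}

/-- Place the diagram `d₂ : Diagram i j` below `d₁ : Diagram j k` and identify the upper dots of `d₂`
with the lower dots of `d₁`. The dots of this picture are the `i` lower, the `j` middle and the `k`
upper ones. This is the inclusion of the dots of `d₂`. -/
def lowerDot (k : ℕ) : Fin i ⊕ Fin j → Fin i ⊕ Fin j ⊕ Fin k :=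
  Sum.elim Sum.inl (fun m => Sum.inr (Sum.inl m))

/-- The inclusion of the dots of the upper diagram `d₁` into the dots of the picture. -/
def upperDot (i : ℕ) : Fin j ⊕ Fin k → Fin i ⊕ Fin j ⊕ Fin k := Sum.inr

/-- The middle dots of the picture. -/
def middleDot (i k : ℕ) (m : Fin j) : Fin i ⊕ Fin j ⊕ Fin k := Sum.inr (Sum.inl m)

/-- The lower and the upper dots of the picture, which are the dots of the concatenation. -/
def outerDot (j : ℕ) : Fin i ⊕ Fin k → Fin i ⊕ Fin j ⊕ Fin k :=
  Sum.elim Sum.inl (fun t => Sum.inr (Sum.inr t))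

/-- Two dots of the picture lie on the same line of the picture. -/
inductive Joined (d₁ : Diagram j k) (d₂ : Diagram i j) :
    Fin i ⊕ Fin j ⊕ Fin k → Fin i ⊕ Fin j ⊕ Fin k → Prop
  | refl (v) : Joined d₁ d₂ v v
  | upper {v} (x) : Joined d₁ d₂ v (upperDot i x) → Joined d₁ d₂ v (upperDot i (d₁.pair x))
  | lower {v} (x) : Joined d₁ d₂ v (lowerDot k x) → Joined d₁ d₂ v (lowerDot k (d₂.pair x))

/-- The picture contains no closed loop: every middle dot lies on a line that ends at an outer dot. -/
def NoLoop (d₁ : Diagram j k) (d₂ : Diagram i j) : Prop :=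
  ∀ m : Fin j, ∃ x : Fin i ⊕ Fin k, Joined d₁ d₂ (middleDot i k m) (outerDot j x)

theorem Joined.trans {d₁ : Diagram j k} {d₂ : Diagram i j} {u v w}
    (h : Joined d₁ d₂ u v) (h' : Joined d₁ d₂ v w) : Joined d₁ d₂ u w := by
  induction h' with
  | refl => exact h
  | upper x _ ih => exact ih.upper x
  | lower x _ ih => exact ih.lower x

theorem joined_upper (d₁ : Diagram j k) (d₂ : Diagram i j) (x) :
    Joined d₁ d₂ (upperDot i x) (upperDot i (d₁.pair x)) := (Joined.refl _).upper x

theorem joined_lower (d₁ : Diagram j k) (d₂ : Diagram i j) (x) :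
    Joined d₁ d₂ (lowerDot k x) (lowerDot k (d₂.pair x)) := (Joined.refl _).lower x

theorem Joined.symm {d₁ : Diagram j k} {d₂ : Diagram i j} {u v}
    (h : Joined d₁ d₂ u v) : Joined d₁ d₂ v u := by
  induction h with
  | refl => exact .refl _
  | upper x _ ih =>
    refine Joined.trans ?_ ih
    simpa [d₁.pair_pair] using joined_upper d₁ d₂ (d₁.pair x)
  | lower x _ ih =>
    refine Joined.trans ?_ ih
    simpa [d₂.pair_pair] using joined_lower d₁ d₂ (d₂.pair x)

/-- Two involutions of a finite set: the orbit of a point fixed by the first one contains exactly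
one further point that is fixed by one of them. -/
theorem exists_other_end {X : Type*} [Finite X] (a b : Equiv.Perm X) (ha : ∀ x, a (a x) = x)
    (hb : ∀ x, b (b x) = x) (hab : ∀ x, a x = x → b x ≠ x) (x : X) (hx : b x = x)
    (r : X → Prop) (r0 : r x) (ra : ∀ y, r y → r (a y)) (rb : ∀ y, r y → r (b y))
    (hr : ∀ s : X → Prop, s x → (∀ y, s y → s (a y)) → (∀ y, s y → s (b y)) → ∀ y, r y → s y) :
    ∃ y, y ≠ x ∧ (a y = y ∨ b y = y) ∧ r y ∧
      ∀ z, r z → (a z = z ∨ b z = z) → z = x ∨ z = y := by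
  classical
  set p : Equiv.Perm X := b * a with hp
  have hbp : ∀ n : ℤ, b ((p ^ n) x) = (p ^ (-n)) x := by
    have e : b * p * b⁻¹ = p⁻¹ := by
      have h1 : b * b = 1 := by ext z; simp [hb]
      have h2 : a * a = 1 := by ext z; simp [ha]
      rw [hp, mul_inv_rev, inv_eq_of_mul_eq_one_left h2, mul_assoc, mul_assoc, ← mul_assoc b b,
        h1, one_mul]
    intro n
    have h1 : b * p ^ n * b⁻¹ = p ^ (-n) := by
      rw [← conj_zpow, e, inv_zpow, zpow_neg]
    have h2 : b⁻¹ x = x := by rw [Equiv.Perm.inv_eq_iff_eq, hx]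
    rw [← h1, Equiv.Perm.mul_apply, Equiv.Perm.mul_apply, h2]
  have hap : ∀ n : ℤ, a ((p ^ n) x) = (p ^ (-(n+1))) x := by
    intro n
    rw [← hbp (n+1), add_comm, zpow_add, zpow_one]
    simp [hp, hb]
  have hfix : ∀ n : ℤ, (p ^ n) x = x ↔ (Function.minimalPeriod p x : ℤ) ∣ n := by
    intro n
    constructor
    · intro h
      have := (MulAction.zpow_smul_eq_iff_minimalPeriod_dvd (a := p) (b := x) (n := n)).1 h
      exact this
    · intro h
      exact (MulAction.zpow_smul_eq_iff_minimalPeriod_dvd (a := p) (b := x) (n := n)).2 h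
  set N := Function.minimalPeriod p x with hN
  have heq : ∀ m n : ℤ, (p ^ m) x = (p ^ n) x ↔ (N : ℤ) ∣ m - n := by
    intro m n
    rw [← hfix, sub_eq_neg_add, zpow_add, zpow_neg, Equiv.Perm.mul_apply,
      Equiv.Perm.inv_eq_iff_eq]
  have hNpos : 0 < N := by
    apply Function.minimalPeriod_pos_of_mem_periodicPts
    exact (Function.Injective.mem_periodicPts p.injective x)
  have hmem : ∀ n : ℕ, r ((p ^ n) x) := by
    intro n
    induction n with
    | zero => simpa using r0
    | succ n ih => rw [pow_succ', Equiv.Perm.mul_apply]; exact rb _ (ra _ ih)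
  have horb : ∀ z, r z → ∃ n : ℤ, z = (p ^ n) x := by
    apply hr
    · exact ⟨0, by simp⟩
    · rintro _ ⟨n, rfl⟩; exact ⟨_, hap n⟩
    · rintro _ ⟨n, rfl⟩; exact ⟨_, hbp n⟩
  rcases Nat.even_or_odd' N with ⟨c, hc | hc⟩
  · refine ⟨(p ^ c) x, ?_, Or.inr ?_, hmem c, ?_⟩
    · have := heq c 0
      simp only [zpow_natCast, zpow_zero, Equiv.Perm.one_apply, sub_zero] at this
      rw [Ne, this, Int.natCast_dvd_natCast]
      intro h; have := Nat.le_of_dvd (by omega) h; omega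
    · have := hbp c
      simp only [zpow_natCast] at this
      rw [this, ← zpow_natCast, heq, hc]; exact ⟨-1, by push_cast; ring⟩
    · intro z hz hf
      obtain ⟨n, rfl⟩ := horb z hz
      rcases hf with hf | hf
      · rw [hap, heq, hc] at hf
        obtain ⟨q, hq⟩ := hf
        push_cast at hq
        exfalso; 
        have : 2 * (c * q + n) = -1 := by linarith
        omega
      · rw [hbp, heq, hc] at hf
        obtain ⟨q, hq⟩ := hf
        push_cast at hq
        have hn : n = - (c * q) := by linarith
        rcases Int.even_or_odd' q with ⟨t, ht | ht⟩
        · left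
          rw [hfix, hc]; exact ⟨-t, by rw [hn, ht]; push_cast; ring⟩
        · right
          rw [← zpow_natCast, heq, hc]; exact ⟨-t-1, by rw [hn, ht]; push_cast; ring⟩
  · refine ⟨(p ^ c) x, ?_, Or.inl ?_, hmem c, ?_⟩
    · intro h
      have h0 := (heq c 0).1 (by simpa using h)
      rw [sub_zero, Int.natCast_dvd_natCast] at h0
      rcases Nat.eq_zero_or_pos c with h1 | h1
      · have hN1 : N = 1 := by omega
        have hpx : p x = x := by
          have := (hfix 1).2 (by rw [hN1]; simp)
          simpa using this
        have hax : a x = x := by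
          have : b (a x) = x := hpx
          have := congrArg b this
          rw [hb, hx] at this; exact this
        exact hab x hax hx
      · have := Nat.le_of_dvd h1 h0; omega
    · have := hap c
      simp only [zpow_natCast] at this
      rw [this, ← zpow_natCast, heq, hc]; exact ⟨-1, by push_cast; ring⟩
    · intro z hz hf
      obtain ⟨n, rfl⟩ := horb z hz
      rcases hf with hf | hf
      · right
        rw [hap, heq, hc] at hf
        obtain ⟨q, hq⟩ := hf
        push_cast at hq
        rw [← zpow_natCast, heq, hc]
        rcases Int.even_or_odd' q with ⟨t, ht | ht⟩
        · exfalso; rw [ht] at hq; ring_nf at hq; 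
          have : 2 * (c * t * 2 + t + n) = -1 := by linarith
          omega
        · refine ⟨-t-1, ?_⟩
          rw [ht] at hq
          push_cast
          linarith
      · left
        rw [hbp, heq, hc] at hf
        obtain ⟨q, hq⟩ := hf
        push_cast at hq
        rw [hfix, hc]
        rcases Int.even_or_odd' q with ⟨t, ht | ht⟩
        · refine ⟨-t, ?_⟩
          rw [ht] at hq; push_cast; linarith
        · exfalso; rw [ht] at hq; ring_nf at hq
          have : 2 * (c * t * 2 + t + n + c) = -1 := by linarith
          omega

theorem glue_aux (d₁ : Diagram j k) (d₂ : Diagram i j) (x : Fin i ⊕ Fin k) :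
    ∃ y, y ≠ x ∧ Joined d₁ d₂ (outerDot j x) (outerDot j y) ∧
      ∀ z, Joined d₁ d₂ (outerDot j x) (outerDot j z) → z = x ∨ z = y := by
  let fa : Fin i ⊕ Fin j ⊕ Fin k → Fin i ⊕ Fin j ⊕ Fin k :=
    Sum.elim (fun p => lowerDot k (d₂.pair (Sum.inl p)))
      (Sum.elim (fun m => lowerDot k (d₂.pair (Sum.inr m))) (fun t => Sum.inr (Sum.inr t)))
  let fb : Fin i ⊕ Fin j ⊕ Fin k → Fin i ⊕ Fin j ⊕ Fin k :=
    Sum.elim Sum.inl (fun y => upperDot i (d₁.pair y))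
  have falow : ∀ y, fa (lowerDot k y) = lowerDot k (d₂.pair y) := by
    rintro (y | y) <;> rfl
  have fbup : ∀ y, fb (upperDot i y) = upperDot i (d₁.pair y) := fun _ => rfl
  have hfa : Function.Involutive fa := by
    rintro (p | m | t)
    · change fa (lowerDot k (d₂.pair (Sum.inl p))) = _
      rw [falow, d₂.pair_pair]; rfl
    · change fa (lowerDot k (d₂.pair (Sum.inr m))) = _
      rw [falow, d₂.pair_pair]; rfl
    · rfl
  have hfb : Function.Involutive fb := by
    rintro (p | y)
    · rfl
    · change fb (upperDot i (d₁.pair y)) = _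
      rw [fbup, d₁.pair_pair]; rfl
  have lowinj : Function.Injective (lowerDot k : Fin i ⊕ Fin j → _) := by
    rintro (y | y) (z | z) h <;> simp_all [lowerDot]
  have outinj : Function.Injective (outerDot j : Fin i ⊕ Fin k → _) := by
    rintro (y | y) (z | z) h <;> simp_all [outerDot]
  have fane : ∀ y, fa (lowerDot k y) ≠ lowerDot k y := by
    intro y h; rw [falow] at h; exact d₂.pair_ne _ (lowinj h)
  have fbne : ∀ y, fb (upperDot i y) ≠ upperDot i y := by
    intro y h; rw [fbup] at h; exact d₁.pair_ne _ (Sum.inr_injective h)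
  have hout : ∀ y, (fa y = y ∨ fb y = y) ↔ ∃ z : Fin i ⊕ Fin k, y = outerDot j z := by
    rintro (p | m | t)
    · exact ⟨fun _ => ⟨Sum.inl p, rfl⟩, fun _ => Or.inr rfl⟩
    · constructor
      · rintro (h | h)
        · exact absurd h (fane (Sum.inr m))
        · exact absurd h (fbne (Sum.inl m))
      · rintro ⟨z | z, h⟩ <;> simp [outerDot] at h
    · exact ⟨fun _ => ⟨Sum.inr t, rfl⟩, fun _ => Or.inl rfl⟩
  have hab : ∀ y, fa y = y → fb y ≠ y := by
    rintro (p | m | t) h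
    · exact absurd h (fane (Sum.inl p))
    · exact absurd h (fane (Sum.inr m))
    · exact fbne (Sum.inr t)
  let a := hfa.toPerm
  let b := hfb.toPerm
  have ra : ∀ v y, Joined d₁ d₂ v y → Joined d₁ d₂ v (a y) := by
    rintro v (p | m | t) h
    · exact h.lower (Sum.inl p)
    · exact h.lower (Sum.inr m)
    · exact h
  have rb : ∀ v y, Joined d₁ d₂ v y → Joined d₁ d₂ v (b y) := by
    rintro v (p | y) h
    · exact h
    · exact h.upper y
  have hr : ∀ v (s : _ → Prop), s v → (∀ y, s y → s (a y)) → (∀ y, s y → s (b y)) →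
      ∀ y, Joined d₁ d₂ v y → s y := by
    intro v s h0 h1 h2 y hy
    induction hy with
    | refl => exact h0
    | upper x _ ih => exact h2 _ ih
    | lower x _ ih => have := h1 _ ih; rwa [show a _ = _ from falow x] at this
  have key : ∃ y, y ≠ outerDot j x ∧ (a y = y ∨ b y = y) ∧ Joined d₁ d₂ (outerDot j x) y ∧
      ∀ z, Joined d₁ d₂ (outerDot j x) z → (a z = z ∨ b z = z) → z = outerDot j x ∨ z = y := by
    rcases x with p | t
    · exact exists_other_end a b hfa hfb hab _ rfl _ (.refl _) (ra _) (rb _) (hr _)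
    · obtain ⟨y, h1, h2, h3, h4⟩ := exists_other_end b a hfb hfa (fun y h h' => hab y h' h)
        (outerDot j (Sum.inr t)) rfl (Joined d₁ d₂ _) (.refl _) (rb _) (ra _)
        (fun s h0 h1 h2 => hr _ s h0 h2 h1)
      exact ⟨y, h1, h2.symm, h3, fun z hz hz' => h4 z hz hz'.symm⟩
  obtain ⟨y, h1, h2, h3, h4⟩ := key
  obtain ⟨z, rfl⟩ := (hout y).1 h2
  refine ⟨z, fun h => h1 (h ▸ rfl), h3, fun w hw => ?_⟩
  rcases h4 _ hw ((hout _).2 ⟨w, rfl⟩) with h | h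
  · exact Or.inl (outinj h)
  · exact Or.inr (outinj h)

/-- Every line of the picture that is not a loop has exactly two ends among the outer dots. -/
theorem exists_stack (d₁ : Diagram j k) (d₂ : Diagram i j) :
    ∃ d : Diagram i k, ∀ x y, Joined d₁ d₂ (outerDot j x) (outerDot j y) ↔ y = x ∨ y = d.pair x := by
  choose f h1 h2 h3 using glue_aux d₁ d₂
  refine ⟨⟨f, fun x => ?_, h1⟩, fun x y => ⟨h3 x y, ?_⟩⟩
  · rcases h3 (f x) x (h2 x).symm with h | h
    · exact absurd h.symm (h1 x)
    · exact h.symm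
  · rintro (rfl | rfl)
    · exact .refl _
    · exact h2 x

/-- The concatenation `d₁ ∗ d₂` (with `d₁` on top of `d₂`, loops removed): it pairs the two ends of
every line of the picture, see `joined_stack` and `stack_eq_of_joined`. -/
noncomputable def stack (d₁ : Diagram j k) (d₂ : Diagram i j) : Diagram i k :=
  (exists_stack d₁ d₂).choose

theorem joined_outer_iff (d₁ : Diagram j k) (d₂ : Diagram i j) (x y) :
    Joined d₁ d₂ (outerDot j x) (outerDot j y) ↔ y = x ∨ y = (stack d₁ d₂).pair x :=
  (exists_stack d₁ d₂).choose_spec x y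

theorem joined_stack (d₁ : Diagram j k) (d₂ : Diagram i j) (x) :
    Joined d₁ d₂ (outerDot j x) (outerDot j ((stack d₁ d₂).pair x)) :=
  (joined_outer_iff d₁ d₂ x _).2 (Or.inr rfl)

theorem stack_eq_of_joined (d₁ : Diagram j k) (d₂ : Diagram i j) (d : Diagram i k)
    (h : ∀ x, Joined d₁ d₂ (outerDot j x) (outerDot j (d.pair x))) : stack d₁ d₂ = d := by
  ext x
  rcases (joined_outer_iff d₁ d₂ x _).1 (h x) with h' | h'
  · exact absurd h' (d.pair_ne x)
  · rw [h']

/-- Two-colourings of the dots that are constant along the lines of a diagram. -/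
def IsColouring (d : Diagram i j) (f : Fin i → Prop) (g : Fin j → Prop) : Prop :=
  ∀ x, Sum.elim f g (d.pair x) = Sum.elim f g x

theorem isColouring_stack (d₁ : Diagram j k) (d₂ : Diagram i j) (f : Fin i → Prop)
    (h : Fin k → Prop) :
    IsColouring (stack d₁ d₂) f h ↔ ∃ g, IsColouring d₂ f g ∧ IsColouring d₁ g h := by
  constructor
  · intro H
    let G : Fin i ⊕ Fin j ⊕ Fin k → Prop := fun v =>
      ∃ x, Joined d₁ d₂ v (outerDot j x) ∧ Sum.elim f h x
    have hG : ∀ v w, Joined d₁ d₂ v w → G v = G w := fun v w hvw => propext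
      ⟨fun ⟨x, hx, h'⟩ => ⟨x, hvw.symm.trans hx, h'⟩, fun ⟨x, hx, h'⟩ => ⟨x, hvw.trans hx, h'⟩⟩
    have hO : ∀ x, G (outerDot j x) = Sum.elim f h x := by
      intro x
      refine propext ⟨?_, fun h' => ⟨x, .refl _, h'⟩⟩
      rintro ⟨y, hy, h'⟩
      rcases (joined_outer_iff d₁ d₂ x y).1 hy with rfl | rfl
      · exact h'
      · rwa [H x] at h'
    refine ⟨fun m => G (middleDot i k m), fun x => ?_, fun x => ?_⟩
    · have e : ∀ y, Sum.elim f (fun m => G (middleDot i k m)) y = G (lowerDot k y) := by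
        rintro (p | m)
        · exact (hO (Sum.inl p)).symm
        · rfl
      rw [e, e]; exact (hG _ _ (joined_lower d₁ d₂ x)).symm
    · have e : ∀ y, Sum.elim (fun m => G (middleDot i k m)) h y = G (upperDot i y) := by
        rintro (m | t)
        · rfl
        · exact (hO (Sum.inr t)).symm
      rw [e, e]; exact (hG _ _ (joined_upper d₁ d₂ x)).symm
  · rintro ⟨g, h2, h1⟩ x
    have key : ∀ v w, Joined d₁ d₂ v w →
        Sum.elim f (Sum.elim g h) v = Sum.elim f (Sum.elim g h) w := by
      intro v w hvw
      induction hvw with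
      | refl => rfl
      | upper x _ ih => rw [ih]; exact (h1 x).symm
      | lower x _ ih =>
        rw [ih]
        have e : ∀ y, Sum.elim f (Sum.elim g h) (lowerDot k y) = Sum.elim f g y := by
          rintro (_ | _) <;> rfl
        rw [e, e]; exact (h2 x).symm
    have := key _ _ (joined_stack d₁ d₂ x)
    have e : ∀ y, Sum.elim f (Sum.elim g h) (outerDot j y) = Sum.elim f h y := by
      rintro (_ | _) <;> rfl
    rw [e, e] at this; exact this.symm

theorem eq_or_eq_pair_of_colour (d : Diagram i j) (x y : Fin i ⊕ Fin j)
    (h : ∀ f g, IsColouring d f g → Sum.elim f g x = Sum.elim f g y) :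
    y = x ∨ y = d.pair x := by
  have := h (fun p => Sum.inl p = x ∨ Sum.inl p = d.pair x)
    (fun q => Sum.inr q = x ∨ Sum.inr q = d.pair x) (by
      have e : ∀ z, Sum.elim (fun p => Sum.inl p = x ∨ Sum.inl p = d.pair x)
          (fun q => Sum.inr q = x ∨ Sum.inr q = d.pair x) z = (z = x ∨ z = d.pair x) := by
        rintro (_ | _) <;> rfl
      intro z
      rw [e, e]
      refine propext ⟨?_, ?_⟩
      · rintro (h | h)
        · right; rw [← h, d.pair_pair]
        · left; rw [← d.pair_pair z, h, d.pair_pair]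
      · rintro (rfl | rfl)
        · exact Or.inr rfl
        · left; rw [d.pair_pair])
  have e : ∀ z, Sum.elim (fun p => Sum.inl p = x ∨ Sum.inl p = d.pair x)
      (fun q => Sum.inr q = x ∨ Sum.inr q = d.pair x) z = (z = x ∨ z = d.pair x) := by
    rintro (_ | _) <;> rfl
  rw [e, e] at this
  exact this ▸ Or.inl rfl

theorem eq_of_isColouring (d d' : Diagram i j)
    (h : ∀ f g, IsColouring d f g ↔ IsColouring d' f g) : d = d' := by
  ext x
  rcases eq_or_eq_pair_of_colour d x (d'.pair x)
    (fun f g hfg => (((h f g).1 hfg) x).symm) with h' | h'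
  · exact absurd h' (d'.pair_ne x)
  · rw [h']

theorem noLoop_iff (d₁ : Diagram j k) (d₂ : Diagram i j) :
    NoLoop d₁ d₂ ↔ ∀ g, IsColouring d₂ (fun _ => False) g → IsColouring d₁ g (fun _ => False) →
      g = fun _ => False := by
  constructor
  · intro H g h2 h1
    funext m
    obtain ⟨x, hx⟩ := H m
    have key : ∀ v w, Joined d₁ d₂ v w →
        Sum.elim (fun _ => False) (Sum.elim g (fun _ => False)) v =
          Sum.elim (fun _ => False) (Sum.elim g (fun _ => False)) w := by
      intro v w hvw
      induction hvw with
      | refl => rfl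
      | upper x _ ih => rw [ih]; exact (h1 x).symm
      | lower x _ ih =>
        rw [ih]
        have e : ∀ y, Sum.elim (fun _ => False) (Sum.elim g (fun _ : Fin k => False))
            (lowerDot k y) = Sum.elim (fun _ : Fin i => False) g y := by
          rintro (_ | _) <;> rfl
        rw [e, e]; exact (h2 x).symm
    have := key _ _ hx
    rcases x with x | x <;> exact this
  · intro H m
    by_contra hm
    let G : Fin i ⊕ Fin j ⊕ Fin k → Prop := fun v => Joined d₁ d₂ (middleDot i k m) v
    have hG : ∀ v w, Joined d₁ d₂ v w → G v = G w := fun v w hvw => propext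
      ⟨fun h => h.trans hvw, fun h => h.trans hvw.symm⟩
    have hO : ∀ x, G (outerDot j x) = False := fun x => eq_false fun h => hm ⟨x, h⟩
    have := H (fun m => G (middleDot i k m)) (fun x => ?_) (fun x => ?_)
    · have h2 := congrFun this m
      exact h2.mp (.refl _)
    · have e : ∀ y, Sum.elim (fun _ => False) (fun m => G (middleDot i k m)) y =
          G (lowerDot k y) := by
        rintro (p | m)
        · exact (hO (Sum.inl p)).symm
        · rfl
      rw [e, e]; exact (hG _ _ (joined_lower d₁ d₂ x)).symm
    · have e : ∀ y, Sum.elim (fun m => G (middleDot i k m)) (fun _ => False) y =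
          G (upperDot i y) := by
        rintro (m | t)
        · rfl
        · exact (hO (Sum.inr t)).symm
      rw [e, e]; exact (hG _ _ (joined_upper d₁ d₂ x)).symm

theorem stack_assoc (d₁ : Diagram k l) (d₂ : Diagram j k) (d₃ : Diagram i j) :
    stack (stack d₁ d₂) d₃ = stack d₁ (stack d₂ d₃) := by
  apply eq_of_isColouring
  intro f g
  simp only [isColouring_stack]
  constructor
  · rintro ⟨a, h1, b, h2, h3⟩; exact ⟨b, ⟨a, h1, h2⟩, h3⟩
  · rintro ⟨b, ⟨a, h1, h2⟩, h3⟩; exact ⟨a, h1, b, h2, h3⟩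

theorem isColouring_false (d : Diagram i j) : IsColouring d (fun _ => False) (fun _ => False) := by
  intro x
  have e : ∀ y : Fin i ⊕ Fin j, Sum.elim (fun _ => False) (fun _ => False) y = False := by
    rintro (_ | _) <;> rfl
  rw [e, e]

theorem noLoop_assoc (d₁ : Diagram k l) (d₂ : Diagram j k) (d₃ : Diagram i j) :
    (NoLoop d₁ d₂ ∧ NoLoop (stack d₁ d₂) d₃) ↔ (NoLoop d₂ d₃ ∧ NoLoop d₁ (stack d₂ d₃)) := by
  simp only [noLoop_iff, isColouring_stack]
  constructor
  · rintro ⟨H1, H2⟩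
    refine ⟨fun g h3 h2 => H2 g h3 ⟨_, h2, isColouring_false _⟩, ?_⟩
    rintro g ⟨a, h3, h2⟩ h1
    obtain rfl := H2 a h3 ⟨g, h2, h1⟩
    exact H1 g h2 h1
  · rintro ⟨H1, H2⟩
    refine ⟨fun g h2 h1 => H2 g ⟨_, isColouring_false _, h2⟩ h1, ?_⟩
    rintro g h3 ⟨a, h2, h1⟩
    obtain rfl := H2 a ⟨g, h3, h2⟩ h1
    exact H1 g h3 h2

/-! ### Signs -/

/-- The exterior algebra of `ℤ ^ n`. A diamond and an arrow are odd symbols, and they are modelled by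
odd operators on exterior algebras. -/
abbrev Fock (n : ℕ) := ExteriorAlgebra ℤ (Fin n → ℤ)

/-- A diamond on a cup that joins the upper dots `x` and `y`: left multiplication by `e_x + e_y`.
It is symmetric in `x` and `y` (`cupOp_flip`). -/
def cupOp {n : ℕ} (x y : Fin n) : Module.End ℤ (Fock n) :=
  LinearMap.mulLeft ℤ (ExteriorAlgebra.ι ℤ (Pi.single x 1 + Pi.single y 1))

/-- The coordinate function `e_x ^ *`. -/
def coord {n : ℕ} (x : Fin n) : Module.Dual ℤ (Fin n → ℤ) := LinearMap.proj x

/-- An arrow from `x` to `y` on a cap that joins the lower dots `x` and `y`: contraction with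
`e_y ^ * - e_x ^ *`. It changes its sign when the arrow is reversed (`capOp_swap`). -/
def capOp {n : ℕ} (x y : Fin n) : Module.End ℤ (Fock n) :=
  CliffordAlgebra.contractLeft (coord y - coord x)

/-- The map that moves the basis vector of a lower dot along the propagating line through it, and
sends the basis vectors of the lower dots on caps to `0`. -/
def strandMap (τ : Fin i ⊕ Fin j → Fin i ⊕ Fin j) : (Fin i → ℤ) →ₗ[ℤ] (Fin j → ℤ) :=
  LinearMap.pi fun q => Sum.elim coord (fun _ => 0) (τ (Sum.inr q))

/-- Equality up to a sign. -/
def EqUpToSign {M : Type*} [Neg M] (a b : M) : Prop := a = b ∨ a = -b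

local infix:50 " ≈± " => EqUpToSign

section sgn
variable {M : Type*} [AddCommGroup M] 
theorem EqUpToSign.refl (a : M) : a ≈± a := Or.inl rfl
theorem EqUpToSign.symm {a b : M} (h : a ≈± b) : b ≈± a := by
  rcases h with rfl | rfl
  · exact .inl rfl
  · exact .inr (neg_neg _).symm
theorem EqUpToSign.trans {a b c : M} (h : a ≈± b) (h' : b ≈± c) : a ≈± c := by
  rcases h with rfl | rfl <;> rcases h' with rfl | rfl
  · exact .inl rfl
  · exact .inr rfl
  · exact .inr rfl
  · exact .inl (neg_neg _)
theorem EqUpToSign.map {N : Type*} [AddCommGroup N] (f : M →+ N) {a b : M} (h : a ≈± b) :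
    f a ≈± f b := by
  rcases h with rfl | rfl
  · exact .inl rfl
  · exact .inr (map_neg _ _)
end sgn

theorem EqUpToSign.comp {U V W : Type*} [AddCommGroup U] [AddCommGroup V] [AddCommGroup W]
    {f f' : V →ₗ[ℤ] W} {g g' : U →ₗ[ℤ] V} (hf : f ≈± f') (hg : g ≈± g') :
    (f ∘ₗ g) ≈± (f' ∘ₗ g') := by
  rcases hf with rfl | rfl <;> rcases hg with rfl | rfl
  · exact .inl rfl
  · exact .inr (LinearMap.comp_neg _ _)
  · exact .inr (LinearMap.neg_comp _ _)
  · exact .inl (by rw [LinearMap.comp_neg, LinearMap.neg_comp, neg_neg])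

theorem EqUpToSign.mul {R : Type*} [Ring R] {a b c d : R} (h : a ≈± b) (h' : c ≈± d) :
    a * c ≈± b * d := by
  rcases h with rfl | rfl <;> rcases h' with rfl | rfl
  · exact .inl rfl
  · exact .inr (by simp)
  · exact .inr (by simp)
  · exact .inl (by simp)

theorem prod_mul_anticomm {R : Type*} [Ring R] (a : R) (L : List R)
    (h : ∀ b ∈ L, a * b = -(b * a)) : a * L.prod ≈± L.prod * a := by
  induction L with
  | nil => left; simp
  | cons b L ih =>
    have ih := ih fun c hc => h c (by simp [hc])
    rw [List.prod_cons, ← mul_assoc, h b (by simp), mul_assoc b]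
    refine .trans ?_ (EqUpToSign.mul (.refl b) ih)
    right; simp [mul_assoc]

/-! ### Lists of disjoint pairs -/

variable {α β : Type*}

/-- The list `L` enumerates the pairs of a matching, each pair once, in one of its two orders. -/
def EnumPairs (r : α → α → Prop) (L : List (α × α)) : Prop :=
  (L.flatMap fun p => [p.1, p.2]).Nodup ∧ (∀ p ∈ L, r p.1 p.2) ∧
    ∀ x y, r x y → (x, y) ∈ L ∨ (y, x) ∈ L

/-- The product of the operators of a list of pairs; the first pair of the list is the topmost one. -/
def opProd {R : Type*} [Ring R] (op : α → α → R) (L : List (α × α)) : R :=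
  (L.map fun p => op p.1 p.2).prod

theorem opProd_perm {R : Type*} [Ring R] (op : α → α → R)
    (anti : ∀ x y z w, op x y * op z w = -(op z w * op x y)) {L L' : List (α × α)}
    (h : L.Perm L') : opProd op L ≈± opProd op L' := by
  induction h with
  | nil => exact .refl _
  | cons x _ ih => simp only [opProd, List.map_cons, List.prod_cons] at *; exact .mul (.refl _) ih
  | swap x y L =>
    right; simp only [opProd, List.map_cons, List.prod_cons, ← mul_assoc]
    rw [anti, neg_mul]
  | trans _ _ ih1 ih2 => exact ih1.trans ih2

theorem EnumPairs.perm {r : α → α → Prop} {L L' : List (α × α)} (h : EnumPairs r L)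
    (hp : L.Perm L') : EnumPairs r L' :=
  ⟨(hp.flatMap_right _).nodup_iff.1 h.1, fun p hp' => h.2.1 p (hp.mem_iff.2 hp'),
    fun x y hxy => by simpa only [hp.mem_iff] using h.2.2 x y hxy⟩

theorem EnumPairs.exists_head {R : Type*} [Ring R] (op : α → α → R)
    (anti : ∀ x y z w, op x y * op z w = -(op z w * op x y))
    (flip : ∀ x y, op x y ≈± op y x) {r : α → α → Prop} (hr : ∀ x y, r x y → r y x)
    {L : List (α × α)} (h : EnumPairs r L) {x y : α} (hxy : r x y) :
    ∃ L', EnumPairs r ((x, y) :: L') ∧ opProd op L ≈± op x y * opProd op L' := by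
  rcases h.2.2 x y hxy with hm | hm
  · obtain ⟨s, t, rfl⟩ := List.append_of_mem hm
    have hp : (s ++ (x, y) :: t).Perm ((x, y) :: (s ++ t)) := List.perm_middle
    exact ⟨s ++ t, h.perm hp, opProd_perm op anti hp⟩
  · obtain ⟨s, t, rfl⟩ := List.append_of_mem hm
    have hp : (s ++ (y, x) :: t).Perm ((y, x) :: (s ++ t)) := List.perm_middle
    have h' := h.perm hp
    refine ⟨s ++ t, ⟨?_, ?_, ?_⟩, (opProd_perm op anti hp).trans (.mul (flip y x) (.refl _))⟩
    · refine (List.Perm.nodup_iff ?_).1 h'.1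
      exact List.Perm.swap _ _ _
    · intro p hp'
      rcases List.mem_cons.1 hp' with rfl | hp'
      · exact hxy
      · exact h'.2.1 p (by simp only [List.mem_cons]; exact Or.inr hp')
    · intro a b hab
      have := h'.2.2 a b hab
      simp only [List.mem_cons, Prod.mk.injEq] at this ⊢
      tauto

theorem EnumPairs.tail {r : α → α → Prop} {L : List (α × α)} {x y : α}
    (h : EnumPairs r ((x, y) :: L)) :
    EnumPairs (fun a b => r a b ∧ (a, b) ≠ (x, y) ∧ (a, b) ≠ (y, x)) L := by
  have h1 := h.1
  simp only [List.flatMap_cons, List.cons_append, List.nil_append, List.nodup_cons,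
    List.mem_cons, List.mem_flatMap, not_or, not_exists, not_and] at h1
  refine ⟨h1.2.2, fun p hp => ⟨h.2.1 p (by simp [hp]), ?_, ?_⟩, ?_⟩
  · intro h2
    have := (h1.1.2 _ hp)
    rw [show p.1 = x from congrArg Prod.fst h2] at this
    simp at this
  · rintro h2
    have := (h1.2.1 _ hp)
    rw [show p.1 = y from congrArg Prod.fst h2] at this
    simp at this
  · rintro a b ⟨hab, h2, h3⟩
    have := h.2.2 a b hab
    simp only [List.mem_cons] at this
    rcases this with (h4 | h4) | (h4 | h4)
    · exact absurd h4 h2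
    · exact Or.inl h4
    · rw [Prod.mk.injEq] at h4; exact absurd (by rw [h4.1, h4.2]) h3
    · exact Or.inr h4

theorem EnumPairs.unique {R : Type*} [Ring R] (op : α → α → R)
    (anti : ∀ x y z w, op x y * op z w = -(op z w * op x y))
    (flip : ∀ x y, op x y ≈± op y x) (L : List (α × α)) :
    ∀ (r : α → α → Prop) (_ : ∀ x y, r x y → r y x) (L' : List (α × α)),
      EnumPairs r L → EnumPairs r L' → opProd op L ≈± opProd op L' := by
  induction L with
  | nil =>
    intro r hr L' h h'
    cases L' with
    | nil => exact .refl _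
    | cons p L' =>
      have := h.2.2 _ _ (h'.2.1 p (by simp))
      simp at this
  | cons p L ih =>
    intro r hr L' h h'
    obtain ⟨x, y⟩ := p
    obtain ⟨L'', h2, h3⟩ := h'.exists_head op anti flip hr (h.2.1 (x, y) (by simp))
    refine EqUpToSign.trans ?_ h3.symm
    refine EqUpToSign.mul (.refl _) (ih _ ?_ _ h.tail h2.tail)
    rintro a b ⟨h1, h2, h3⟩
    simp only [ne_eq, Prod.mk.injEq, not_and] at h2 h3 ⊢
    exact ⟨hr _ _ h1, fun ha hb => h3 hb ha, fun ha hb => h2 hb ha⟩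

/-! ### Operators on the exterior algebra -/

theorem contractLeft_ι_mul' (f : Module.Dual ℤ (Fin n → ℤ)) (v : Fin n → ℤ) (ψ : Fock n) :
    CliffordAlgebra.contractLeft f (ExteriorAlgebra.ι ℤ v * ψ) =
      f v • ψ - ExteriorAlgebra.ι ℤ v * CliffordAlgebra.contractLeft f ψ :=
  CliffordAlgebra.contractLeft_ι_mul f v ψ

theorem contractLeft_map (φ : (Fin n → ℤ) →ₗ[ℤ] (Fin m → ℤ)) (f : Module.Dual ℤ (Fin m → ℤ))
    (ψ : Fock n) : CliffordAlgebra.contractLeft f (ExteriorAlgebra.map φ ψ) =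
      ExteriorAlgebra.map φ (CliffordAlgebra.contractLeft (f ∘ₗ φ) ψ) := by
  induction ψ using CliffordAlgebra.left_induction with
  | algebraMap r =>
    rw [AlgHom.commutes, CliffordAlgebra.contractLeft_algebraMap,
      CliffordAlgebra.contractLeft_algebraMap, map_zero]
  | add x y hx hy => simp only [map_add, hx, hy]
  | ι_mul x v hx =>
    rw [map_mul, show ExteriorAlgebra.map φ (CliffordAlgebra.ι 0 v) = ExteriorAlgebra.ι ℤ (φ v)
      from ExteriorAlgebra.map_apply_ι φ v, contractLeft_ι_mul', hx,
      CliffordAlgebra.contractLeft_ι_mul, map_sub, map_mul,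
      show ExteriorAlgebra.map φ (CliffordAlgebra.ι 0 v) = ExteriorAlgebra.ι ℤ (φ v)
      from ExteriorAlgebra.map_apply_ι φ v, map_smul]
    rfl

theorem map_rank_one (f : Module.Dual ℤ (Fin n → ℤ)) (w : Fin n → ℤ) (ψ : Fock n) :
    ExteriorAlgebra.map (LinearMap.id + f.smulRight w) ψ =
      ψ + ExteriorAlgebra.ι ℤ w * CliffordAlgebra.contractLeft f ψ := by
  induction ψ using CliffordAlgebra.left_induction with
  | algebraMap r =>
    rw [AlgHom.commutes, CliffordAlgebra.contractLeft_algebraMap, mul_zero, add_zero]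
  | add x y hx hy => simp only [map_add, hx, hy, mul_add]; abel
  | ι_mul x v hx =>
    rw [map_mul, show ExteriorAlgebra.map (LinearMap.id + f.smulRight w) (CliffordAlgebra.ι 0 v)
      = ExteriorAlgebra.ι ℤ ((LinearMap.id + f.smulRight w : (Fin n → ℤ) →ₗ[ℤ] (Fin n → ℤ)) v)
      from ExteriorAlgebra.map_apply_ι _ v, hx, CliffordAlgebra.contractLeft_ι_mul]
    change ExteriorAlgebra.ι ℤ (v + f v • w) * _ = ExteriorAlgebra.ι ℤ v * x +
      ExteriorAlgebra.ι ℤ w * (f v • x - ExteriorAlgebra.ι ℤ v * _)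
    have h1 := ExteriorAlgebra.ι_add_mul_swap (R := ℤ) v w
    have h2 := ExteriorAlgebra.ι_sq_zero (R := ℤ) w
    rw [map_add, map_smul]
    generalize ExteriorAlgebra.ι ℤ v = V at *
    generalize ExteriorAlgebra.ι ℤ w = W at *
    generalize CliffordAlgebra.contractLeft f x = Y at *
    have h3 : V * W = - (W * V) := eq_neg_of_add_eq_zero_left h1
    simp only [add_mul, mul_add, mul_sub, smul_mul_assoc, mul_smul_comm, ← mul_assoc, h2, h3,
      zero_mul, smul_zero, neg_mul]
    abel

/-- Exchanging the latitudes of two diamonds costs a sign. -/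
theorem cupOp_anti (x y z w : Fin n) : cupOp x y * cupOp z w = -(cupOp z w * cupOp x y) := by
  refine LinearMap.ext fun ψ => ?_
  simp only [cupOp, Module.End.mul_apply, LinearMap.neg_apply, LinearMap.mulLeft_apply,
    ← mul_assoc]
  rw [eq_neg_of_add_eq_zero_left (ExteriorAlgebra.ι_add_mul_swap (R := ℤ) _ _), neg_mul]

/-- Exchanging the latitudes of two arrows costs a sign. -/
theorem capOp_anti (x y z w : Fin n) : capOp x y * capOp z w = -(capOp z w * capOp x y) := by
  refine LinearMap.ext fun ψ => ?_
  exact CliffordAlgebra.contractLeft_comm _ _ ψ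

theorem cupOp_flip (x y : Fin n) : cupOp x y ≈± cupOp y x := by
  left; rw [cupOp, cupOp, add_comm]

theorem capOp_swap (x y : Fin n) : capOp x y = -capOp y x := by
  unfold capOp; rw [← neg_sub, map_neg]

theorem capOp_flip (x y : Fin n) : capOp x y ≈± capOp y x := .inr (capOp_swap x y)

/-- The matching that results from `τ` when the dots `x` and `y` are joined by a cap; both dots become
fixed points. -/
def contract (τ : Fin i ⊕ Fin j → Fin i ⊕ Fin j) (x y : Fin j) (w : Fin i ⊕ Fin j) :
    Fin i ⊕ Fin j :=
  if w = Sum.inr x ∨ w = Sum.inr y then w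
  else if w = τ (Sum.inr x) then τ (Sum.inr y)
  else if w = τ (Sum.inr y) then τ (Sum.inr x)
  else τ w

/-- `x` and `y` are joined by a cup. -/
def CupRel (τ : Fin i ⊕ Fin j → Fin i ⊕ Fin j) (x y : Fin j) : Prop :=
  x ≠ y ∧ τ (Sum.inr x) = Sum.inr y

/-- `x` and `y` are joined by a cap. -/
def CapRel (τ : Fin i ⊕ Fin j → Fin i ⊕ Fin j) (x y : Fin i) : Prop :=
  x ≠ y ∧ τ (Sum.inl x) = Sum.inl y

/-- `f` is, up to a sign, the product of the diamonds, strands and arrows of the matching `τ`. -/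
def Represents (τ : Fin i ⊕ Fin j → Fin i ⊕ Fin j) (f : Fock i →ₗ[ℤ] Fock j) : Prop :=
  ∃ L L', EnumPairs (CupRel τ) L ∧ EnumPairs (CapRel τ) L' ∧
    f ≈± opProd cupOp L ∘ₗ (ExteriorAlgebra.map (strandMap τ)).toLinearMap ∘ₗ opProd capOp L'

/-- `G` vanishes on multiples of `e_x`: no line continues above the dot `x`. -/
def Kills (G : Fock j →ₗ[ℤ] Fock k) (x : Fin j) : Prop :=
  ∀ ψ : Fock j, G (ExteriorAlgebra.ι ℤ (Pi.single x 1 : Fin j → ℤ) * ψ) = 0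

theorem ne_aux {τ : Fin i ⊕ Fin j → Fin i ⊕ Fin j} (hτ : ∀ w, τ (τ w) = w) {x y : Fin j}
    (hn : τ (Sum.inr x) ≠ Sum.inr y) : τ (Sum.inr y) ≠ Sum.inr x := fun h => hn (by rw [← h, hτ])

theorem ne_aux2 {τ : Fin i ⊕ Fin j → Fin i ⊕ Fin j} (hτ : ∀ w, τ (τ w) = w) {x y : Fin j}
    (hxy : x ≠ y) : τ (Sum.inr x) ≠ τ (Sum.inr y) := fun h => hxy (by
  have := congrArg τ h; rw [hτ, hτ] at this; exact Sum.inr_injective this)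

theorem contract_comm {τ : Fin i ⊕ Fin j → Fin i ⊕ Fin j} (hτ : ∀ w, τ (τ w) = w) {x y : Fin j}
    (hxy : x ≠ y) (hx : τ (Sum.inr x) ≠ Sum.inr x) (hy : τ (Sum.inr y) ≠ Sum.inr y)
    (hn : τ (Sum.inr x) ≠ Sum.inr y) : contract τ x y = contract τ y x := by
  have := ne_aux2 hτ hxy
  funext w
  unfold contract
  split_ifs <;> simp_all

theorem contract_contract {τ : Fin i ⊕ Fin j → Fin i ⊕ Fin j} (hτ : ∀ w, τ (τ w) = w) {x y : Fin j}
    (hxy : x ≠ y) (hx : τ (Sum.inr x) ≠ Sum.inr x) (hy : τ (Sum.inr y) ≠ Sum.inr y)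
    (hn : τ (Sum.inr x) ≠ Sum.inr y) (w) : contract τ x y (contract τ x y w) = w := by
  have h1 := ne_aux hτ hn
  have h2 := ne_aux2 hτ hxy
  unfold contract
  by_cases ha : w = Sum.inr x
  · simp [ha]
  by_cases hb : w = Sum.inr y
  · simp [hb]
  by_cases hc : w = τ (Sum.inr x)
  · simp_all
  by_cases hd : w = τ (Sum.inr y)
  · simp_all
  · have e1 : τ w ≠ Sum.inr x := fun h => hc (by rw [← h, hτ])
    have e2 : τ w ≠ Sum.inr y := fun h => hd (by rw [← h, hτ])
    have e3 : τ w ≠ τ (Sum.inr x) := fun h => ha (by rw [← hτ w, h, hτ])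
    have e4 : τ w ≠ τ (Sum.inr y) := fun h => hb (by rw [← hτ w, h, hτ])
    simp only [ha, hb, hc, hd, e1, e2, e3, e4, or_self, if_false, hτ]

theorem contract_fixed_iff {τ : Fin i ⊕ Fin j → Fin i ⊕ Fin j} (hτ : ∀ w, τ (τ w) = w) {x y : Fin j}
    (hxy : x ≠ y) (hn : τ (Sum.inr x) ≠ Sum.inr y) (w) :
    contract τ x y w = w ↔ τ w = w ∨ w = Sum.inr x ∨ w = Sum.inr y := by
  have h1 := ne_aux hτ hn
  have h2 := ne_aux2 hτ hxy
  unfold contract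
  by_cases ha : w = Sum.inr x
  · simp [ha]
  by_cases hb : w = Sum.inr y
  · simp [hb]
  by_cases hc : w = τ (Sum.inr x)
  · have e1 : τ (Sum.inr y) ≠ w := fun h => h2 (by rw [h, hc])
    have e2 : τ w ≠ w := fun h => ha (by rw [← h, hc, hτ])
    rw [if_neg (by simp [ha, hb]), if_pos hc]
    simp [e1, e2, ha, hb]
  by_cases hd : w = τ (Sum.inr y)
  · have e1 : τ (Sum.inr x) ≠ w := fun h => h2 (by rw [h, hd])
    have e2 : τ w ≠ w := fun h => hb (by rw [← h, hd, hτ])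
    rw [if_neg (by simp [ha, hb]), if_neg hc, if_pos hd]
    simp [e1, e2, ha, hb]
  · simp only [ha, hb, hc, hd, or_self, if_false, or_false]

theorem opProd_cons {R α : Type*} [Ring R] (op : α → α → R) (p : α × α) (L) :
    opProd op (p :: L) = op p.1 p.2 * opProd op L := by simp [opProd]

theorem map_cupProd (s : (Fin n → ℤ) →ₗ[ℤ] (Fin m → ℤ)) (ren : Fin n → Fin m)
    (L : List (Fin n × Fin n))
    (h : ∀ p ∈ L, s (Pi.single p.1 1) = Pi.single (ren p.1) 1 ∧
      s (Pi.single p.2 1) = Pi.single (ren p.2) 1) :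
    (ExteriorAlgebra.map s).toLinearMap ∘ₗ opProd cupOp L =
      opProd cupOp (L.map fun p => (ren p.1, ren p.2)) ∘ₗ (ExteriorAlgebra.map s).toLinearMap := by
  induction L with
  | nil => rfl
  | cons p L ih =>
    have ih := ih fun q hq => h q (by simp [hq])
    rw [List.map_cons, opProd_cons, opProd_cons]
    refine LinearMap.ext fun ψ => ?_
    have := congrArg (fun F => F ψ) ih
    simp only [LinearMap.comp_apply, AlgHom.toLinearMap_apply, Module.End.mul_apply] at this ⊢
    rw [← this]
    simp only [cupOp, LinearMap.mulLeft_apply, map_mul, ExteriorAlgebra.map_apply_ι, map_add,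
      (h p (by simp)).1, (h p (by simp)).2]

/-- Exchanging the latitudes of an arrow and a diamond on disjoint lines costs a sign. -/
theorem contract_mul_cup (f : Module.Dual ℤ (Fin n → ℤ)) (x y : Fin n)
    (h : f (Pi.single x 1 + Pi.single y 1) = 0) :
    (CliffordAlgebra.contractLeft f : Module.End ℤ (Fock n)) * cupOp x y =
      -(cupOp x y * CliffordAlgebra.contractLeft f) := by
  refine LinearMap.ext fun ψ => ?_
  simp only [cupOp, Module.End.mul_apply, LinearMap.neg_apply, LinearMap.mulLeft_apply]
  rw [contractLeft_ι_mul', h, zero_smul, zero_sub]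

theorem contract_mul_cupProd (f : Module.Dual ℤ (Fin n → ℤ)) (L : List (Fin n × Fin n))
    (h : ∀ p ∈ L, f (Pi.single p.1 1 + Pi.single p.2 1) = 0) :
    (CliffordAlgebra.contractLeft f : Module.End ℤ (Fock n)) * opProd cupOp L ≈±
      opProd cupOp L * CliffordAlgebra.contractLeft f := by
  apply prod_mul_anticomm
  intro b hb
  obtain ⟨p, hp, rfl⟩ := List.mem_map.1 hb
  exact contract_mul_cup f _ _ (h p hp)

theorem contract_comp_strand (f : Module.Dual ℤ (Fin m → ℤ))
    (φ : (Fin n → ℤ) →ₗ[ℤ] (Fin m → ℤ)) :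
    (CliffordAlgebra.contractLeft f : Module.End ℤ (Fock m)) ∘ₗ
      (ExteriorAlgebra.map φ).toLinearMap =
    (ExteriorAlgebra.map φ).toLinearMap ∘ₗ
      (CliffordAlgebra.contractLeft (f ∘ₗ φ) : Module.End ℤ (Fock n)) :=
  LinearMap.ext fun ψ => contractLeft_map φ f ψ

theorem coord_single (x y : Fin n) : coord x (Pi.single y 1) = if x = y then 1 else 0 := by
  simp [coord, Pi.single_apply]

theorem coord_comp_strandMap (τ : Fin i ⊕ Fin j → Fin i ⊕ Fin j) (x : Fin j) :
    coord x ∘ₗ strandMap τ = Sum.elim coord (fun _ => 0) (τ (Sum.inr x)) := by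
  rfl

theorem map_comp_strand (s : (Fin j → ℤ) →ₗ[ℤ] (Fin k → ℤ)) (φ : (Fin i → ℤ) →ₗ[ℤ] (Fin j → ℤ)) :
    (ExteriorAlgebra.map s).toLinearMap ∘ₗ (ExteriorAlgebra.map φ).toLinearMap =
      (ExteriorAlgebra.map (s ∘ₗ φ)).toLinearMap := by
  rw [← ExteriorAlgebra.map_comp_map]; rfl

/-- Points of the pairs in a list are pairwise different. -/
theorem nodup_cons {α : Type*} {x y : α} {L : List (α × α)}
    (h : (((x, y) :: L).flatMap fun p => [p.1, p.2]).Nodup) :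
    x ≠ y ∧ (∀ p ∈ L, p.1 ≠ x ∧ p.1 ≠ y ∧ p.2 ≠ x ∧ p.2 ≠ y) ∧
      (L.flatMap fun p => [p.1, p.2]).Nodup := by
  simp only [List.flatMap_cons, List.cons_append, List.nil_append, List.nodup_cons,
    List.mem_cons, List.mem_flatMap, not_or, not_exists, not_and] at h
  refine ⟨h.1.1, fun p hp => ?_, h.2.2⟩
  have h1 := h.1.2 p hp
  have h2 := h.2.1 p hp
  exact ⟨fun e => h1.1 e.symm, fun e => h2.1 e.symm, fun e => h1.2.1 e.symm, fun e => h2.2.1 e.symm⟩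

theorem cupRel_symm {τ : Fin i ⊕ Fin j → Fin i ⊕ Fin j} (hτ : ∀ w, τ (τ w) = w) (x y)
    (h : CupRel τ x y) : CupRel τ y x := ⟨h.1.symm, by rw [← h.2, hτ]⟩

theorem capRel_symm {τ : Fin i ⊕ Fin j → Fin i ⊕ Fin j} (hτ : ∀ w, τ (τ w) = w) (x y)
    (h : CapRel τ x y) : CapRel τ y x := ⟨h.1.symm, by rw [← h.2, hτ]⟩

theorem capRel_contract_cup {τ : Fin i ⊕ Fin j → Fin i ⊕ Fin j} (hτ : ∀ w, τ (τ w) = w)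
    {x y z : Fin j} (hz : τ (Sum.inr y) = Sum.inr z) (p q : Fin i) :
    CapRel (contract τ x y) p q ↔ CapRel τ p q := by
  unfold CapRel contract
  have hz' : τ (Sum.inr z) = Sum.inr y := by rw [← hz, hτ]
  by_cases hp : Sum.inl p = τ (Sum.inr x)
  · have : τ (Sum.inl p) = Sum.inr x := by rw [hp, hτ]
    simp [hz, this, ← hp]
  · simp [hz, hp]

/-- Cancellation: an arrow from `x` to `y` directly above a diamond on a cup that joins `y` and `z`
is replaced, without a sign, by a line from `x` to `z` (the equality `key` in the proof). -/
theorem step_cup {τ : Fin i ⊕ Fin j → Fin i ⊕ Fin j} (hτ : ∀ w, τ (τ w) = w) {x y z : Fin j}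
    (hxy : x ≠ y) (hx : τ (Sum.inr x) ≠ Sum.inr x) (hy : τ (Sum.inr y) ≠ Sum.inr y)
    (hn : τ (Sum.inr x) ≠ Sum.inr y) (hz : τ (Sum.inr y) = Sum.inr z)
    {f : Fock i →ₗ[ℤ] Fock j} (hf : Represents τ f) (G : Fock j →ₗ[ℤ] Fock k)
    (Gx : Kills G x)
    (Gy : Kills G y) :
    ∃ g, Represents (contract τ x y) g ∧ G ∘ₗ capOp x y ∘ₗ f ≈± G ∘ₗ g := by
  obtain ⟨L, L', hL, hL', hf⟩ := hf
  have hzx : z ≠ x := fun h => ne_aux hτ hn (h ▸ hz)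
  have hzy : z ≠ y := fun h => hy (h ▸ hz)
  have hz' : τ (Sum.inr z) = Sum.inr y := by rw [← hz, hτ]
  obtain ⟨L0, hL0, e0⟩ := hL.exists_head cupOp cupOp_anti cupOp_flip (cupRel_symm hτ)
    (x := y) (y := z) ⟨hzy.symm, hz⟩
  set A := (ExteriorAlgebra.map (strandMap τ)).toLinearMap ∘ₗ opProd capOp L' with hA
  set f0 := opProd cupOp L0 ∘ₗ A with hf0
  set s : (Fin j → ℤ) →ₗ[ℤ] (Fin j → ℤ) :=
    LinearMap.id + (coord x).smulRight (Pi.single z 1 - Pi.single x 1) with hs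
  let ren : Fin j → Fin j := fun a => if a = x then z else a
  have hsren : ∀ a, s (Pi.single a 1) = Pi.single (ren a) 1 := by
    intro a
    simp only [hs, LinearMap.add_apply, LinearMap.id_apply, LinearMap.smulRight_apply,
      coord_single, ren]
    by_cases h : a = x
    · simp [h]
    · simp [h, Ne.symm h]
  have hnd := nodup_cons hL0.1
  refine ⟨(ExteriorAlgebra.map s).toLinearMap ∘ₗ f0, ⟨L0.map (fun p => (ren p.1, ren p.2)), L',
    ⟨?_, ?_, ?_⟩, ?_, ?_⟩, ?_⟩
  · have : ((L0.map (fun p => (ren p.1, ren p.2))).flatMap fun p => [p.1, p.2]) =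
        (L0.flatMap fun p => [p.1, p.2]).map ren := by
      rw [List.flatMap_map, List.map_flatMap]; rfl
    rw [this]
    refine List.Nodup.map_on ?_ hnd.2.2
    have hz0 : ∀ a ∈ (L0.flatMap fun p => [p.1, p.2]), a ≠ z := by
      intro a ha
      obtain ⟨p, hp, ha⟩ := List.mem_flatMap.1 ha
      have := hnd.2.1 p hp
      simp only [List.mem_cons, List.not_mem_nil, or_false] at ha
      rcases ha with rfl | rfl
      · exact this.2.1
      · exact this.2.2.2
    intro a ha b hb hab
    have h1 := hz0 a ha
    have h2 := hz0 b hb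
    simp only [ren] at hab
    split_ifs at hab with h3 h4 h4
    · rw [h3, h4]
    · exact absurd hab.symm h2
    · exact absurd hab h1
    · exact hab
  · intro q hq
    obtain ⟨p, hp, rfl⟩ := List.mem_map.1 hq
    have h1 := hnd.2.1 p hp
    have h2 := hL0.2.1 p (by simp [hp])
    have h3 := cupRel_symm hτ _ _ h2
    obtain ⟨a, b⟩ := p
    simp only at h1 h2 h3 ⊢
    unfold CupRel contract at *
    by_cases ha : a = x
    · subst ha
      have hb : b ≠ a := h3.1
      simp only [ren, if_true, hb, if_false]
      refine ⟨Ne.symm h1.2.2.2, ?_⟩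
      simp [hzx, hzy, h2.2, h1.2.2.2.symm, hz]
    · by_cases hb : b = x
      · subst hb
        simp only [ren, if_true, ha, if_false]
        refine ⟨h1.2.1, ?_⟩
        simp [ha, h1.1, h3.2, hz]
      · simp only [ren, ha, hb, if_false]
        refine ⟨h2.1, ?_⟩
        have e1 : (Sum.inr a : Fin i ⊕ Fin j) ≠ τ (Sum.inr x) := by
          intro h; rw [h, hτ] at h2; exact hb (Sum.inr_injective h2.2).symm
        simp [ha, h1.1, e1, hz, h1.2.1, h2.2]
  · rintro a b ⟨hab, h⟩
    unfold contract at h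
    by_cases ha1 : a = x
    · subst ha1; simp at h; exact absurd h hab
    by_cases ha2 : a = y
    · subst ha2; simp at h; exact absurd h hab
    simp only [Sum.inr.injEq, ha1, ha2, or_self, if_false] at h
    by_cases ha3 : (Sum.inr a : Fin i ⊕ Fin j) = τ (Sum.inr x)
    · rw [if_pos ha3, hz] at h
      obtain rfl := Sum.inr_injective h
      have := hL0.2.2 a x ⟨ha1, by rw [ha3, hτ]⟩
      simp only [List.mem_cons, Prod.mk.injEq] at this
      have h5 : ren a = a := by simp [ren, ha1]
      have h6 : ren x = z := by simp [ren]
      rcases this with (h4 | h4) | (h4 | h4)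
      · exact absurd h4.1 ha2
      · left; exact List.mem_map.2 ⟨_, h4, by simp [h5, h6]⟩
      · exact absurd h4.1 hxy
      · right; exact List.mem_map.2 ⟨_, h4, by simp [h5, h6]⟩
    · rw [if_neg ha3] at h
      by_cases ha4 : (Sum.inr a : Fin i ⊕ Fin j) = τ (Sum.inr y)
      · rw [if_pos ha4] at h
        rw [hz] at ha4
        obtain rfl := Sum.inr_injective ha4
        have hbx : b ≠ x := fun hh => hx (hh ▸ h)
        have := hL0.2.2 b x ⟨hbx, by rw [← h, hτ]⟩
        simp only [List.mem_cons, Prod.mk.injEq] at this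
        have h5 : ren b = b := by simp [ren, hbx]
        have h6 : ren x = a := by simp [ren]
        rcases this with (h4 | h4) | (h4 | h4)
        · exact absurd h4.2.symm hzx
        · right; exact List.mem_map.2 ⟨_, h4, by simp [h5, h6]⟩
        · exact absurd h4.1 hxy
        · left; exact List.mem_map.2 ⟨_, h4, by simp [h5, h6]⟩
      · rw [if_neg ha4] at h
        have hbx : b ≠ x := by rintro rfl; exact ha3 (by rw [← h, hτ])
        have haz : a ≠ z := by rintro rfl; exact ha4 hz.symm
        have := hL0.2.2 a b ⟨hab, h⟩
        simp only [List.mem_cons, Prod.mk.injEq] at this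
        have h5 : ren b = b := by simp [ren, hbx]
        have h6 : ren a = a := by simp [ren, ha1]
        rcases this with (h4 | h4) | (h4 | h4)
        · exact absurd h4.1 ha2
        · left; exact List.mem_map.2 ⟨_, h4, by simp [h5, h6]⟩
        · exact absurd h4.2 haz
        · right; exact List.mem_map.2 ⟨_, h4, by simp [h5, h6]⟩
  · have : CapRel (contract τ x y) = CapRel τ := by
      funext p q; exact propext (capRel_contract_cup hτ hz p q)
    rw [this]; exact hL'
  · left
    rw [hf0, hA, ← LinearMap.comp_assoc, map_cupProd s ren L0 (fun p _ => ⟨hsren _, hsren _⟩),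
      LinearMap.comp_assoc, ← LinearMap.comp_assoc, ← LinearMap.comp_assoc, ← LinearMap.comp_assoc]
    congr 1
    rw [LinearMap.comp_assoc, map_comp_strand]
    congr 3
    refine LinearMap.ext fun v => funext fun q => ?_
    change (strandMap τ v + (strandMap τ v x) • ((Pi.single z 1 - Pi.single x 1 : Fin j → ℤ))) q =
      Sum.elim coord (fun _ => 0) (contract τ x y (Sum.inr q)) v
    change Sum.elim coord (fun _ => 0) (τ (Sum.inr q)) v +
      (Sum.elim coord (fun _ => 0) (τ (Sum.inr x)) v) • (Pi.single z 1 - Pi.single x 1 : Fin j → ℤ) q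
       = _
    unfold contract
    by_cases hq1 : q = x
    · subst hq1; simp [hzx.symm]
    by_cases hq2 : q = y
    · subst hq2; simp [hz, hxy.symm, hzy.symm]
    by_cases hq3 : q = z
    · subst hq3
      simp [hzx, hzy, hz', hz]
      split_ifs with h
      · rw [← h]
      · rfl
    · simp only [Sum.inr.injEq, hq1, hq2, or_self, if_false, hz, hq3]
      by_cases hq4 : (Sum.inr q : Fin i ⊕ Fin j) = τ (Sum.inr x)
      · have : τ (Sum.inr q) = Sum.inr x := by rw [hq4, hτ]
        simp [← hq4, this]
      · simp [hq4, hq1, hq3]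
  · have hf' : f ≈± cupOp y z ∘ₗ f0 := by
      refine hf.trans ?_
      rw [hf0, ← LinearMap.comp_assoc]
      exact EqUpToSign.comp (g := A) (g' := A) e0 (.refl _)
    have key : G ∘ₗ capOp x y ∘ₗ cupOp y z ∘ₗ f0 =
        G ∘ₗ (ExteriorAlgebra.map s).toLinearMap ∘ₗ f0 := by
      refine LinearMap.ext fun ψ => ?_
      have hy0 : CliffordAlgebra.contractLeft (coord y) (f0 ψ) = 0 := by
        have h1 : (CliffordAlgebra.contractLeft (coord y) : Module.End ℤ (Fock j)) ∘ₗ f0 ≈± 0 := by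
          rw [hf0, ← LinearMap.comp_assoc]
          refine (EqUpToSign.comp (contract_mul_cupProd (coord y) L0 ?_) (.refl A)).trans ?_
          · intro p hp
            have := hnd.2.1 p hp
            rw [map_add, coord_single, coord_single, if_neg this.1.symm, if_neg this.2.2.1.symm]
            rfl
          · left
            rw [Module.End.mul_eq_comp, LinearMap.comp_assoc, hA,
              ← LinearMap.comp_assoc (opProd capOp L'), contract_comp_strand,
              coord_comp_strandMap, hz]
            simp
        rcases h1 with h1 | h1
        · exact congrArg (fun F => F ψ) h1
        · rw [neg_zero] at h1; exact congrArg (fun F => F ψ) h1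
      simp only [LinearMap.comp_apply, AlgHom.toLinearMap_apply]
      generalize f0 ψ = χ at hy0 ⊢
      rw [hs, map_rank_one]
      simp only [capOp, cupOp, LinearMap.mulLeft_apply]
      have e2 : CliffordAlgebra.contractLeft (coord y - coord x) χ =
          -CliffordAlgebra.contractLeft (coord x) χ := by
        rw [map_sub, LinearMap.sub_apply, hy0, zero_sub]
      have e1 : (coord y - coord x) (Pi.single y (1:ℤ) + Pi.single z 1) = 1 := by
        simp [coord_single, hzy.symm, hxy, hzx.symm]
      rw [contractLeft_ι_mul', e1, e2, one_smul, mul_neg, sub_neg_eq_add, map_add, map_add, map_add, add_mul,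
        map_add, Gy, zero_add, map_sub, sub_mul, map_sub, Gx, sub_zero]
    rw [← key]
    exact EqUpToSign.comp (.refl G) (EqUpToSign.comp (.refl _) hf')

/-- An arrow above two propagating lines slides down along them and becomes an arrow on a cap. -/
theorem step_strand {τ : Fin i ⊕ Fin j → Fin i ⊕ Fin j} (hτ : ∀ w, τ (τ w) = w) {x y : Fin j}
    {p q : Fin i}
    (hxy : x ≠ y) (hp : τ (Sum.inr x) = Sum.inl p) (hq : τ (Sum.inr y) = Sum.inl q)
    {f : Fock i →ₗ[ℤ] Fock j} (hf : Represents τ f) (G : Fock j →ₗ[ℤ] Fock k)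
    (Gx : Kills G x)
    (Gy : Kills G y) :
    ∃ g, Represents (contract τ x y) g ∧ G ∘ₗ capOp x y ∘ₗ f ≈± G ∘ₗ g := by
  obtain ⟨L, L', hL, hL', hf⟩ := hf
  have hp' : τ (Sum.inl p) = Sum.inr x := by rw [← hp, hτ]
  have hq' : τ (Sum.inl q) = Sum.inr y := by rw [← hq, hτ]
  have hpq : p ≠ q := by
    rintro rfl; rw [hp'] at hq'; exact hxy (Sum.inr_injective hq')
  have hLxy : ∀ r ∈ L, r.1 ≠ x ∧ r.1 ≠ y ∧ r.2 ≠ x ∧ r.2 ≠ y := by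
    intro r hr
    have h1 := hL.2.1 r hr
    have h2 := cupRel_symm hτ _ _ h1
    refine ⟨?_, ?_, ?_, ?_⟩ <;> intro h
    · rw [h, CupRel, hp] at h1; simp at h1
    · rw [h, CupRel, hq] at h1; simp at h1
    · rw [h, CupRel, hp] at h2; simp at h2
    · rw [h, CupRel, hq] at h2; simp at h2
  let kill : Fin j → (Fin j → ℤ) →ₗ[ℤ] (Fin j → ℤ) := fun a =>
    LinearMap.id + (coord a).smulRight (-Pi.single a 1)
  have hkill : ∀ a b, kill a (Pi.single b 1) = if a = b then 0 else Pi.single b 1 := by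
    intro a b
    simp only [kill, LinearMap.add_apply, LinearMap.id_apply, LinearMap.smulRight_apply,
      coord_single]
    by_cases h : a = b
    · simp [h]
    · simp [h]
  have Gkill : ∀ a, Kills G a →
      G ∘ₗ (ExteriorAlgebra.map (kill a)).toLinearMap = G := by
    intro a ha
    refine LinearMap.ext fun ψ => ?_
    simp only [LinearMap.comp_apply, AlgHom.toLinearMap_apply, kill]
    rw [map_rank_one, map_add, map_neg, neg_mul, map_neg, ha, neg_zero, add_zero]
  let s := kill x ∘ₗ kill y
  have Gs : G ∘ₗ (ExteriorAlgebra.map s).toLinearMap = G := by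
    rw [← map_comp_strand, ← LinearMap.comp_assoc, Gkill x Gx, Gkill y Gy]
  have hsL : ∀ r ∈ L, s (Pi.single r.1 1) = Pi.single (id r.1) 1 ∧
      s (Pi.single r.2 1) = Pi.single (id r.2) 1 := by
    intro r hr
    have := hLxy r hr
    simp only [s, LinearMap.comp_apply, hkill, if_neg this.1.symm, if_neg this.2.1.symm,
      if_neg this.2.2.1.symm, if_neg this.2.2.2.symm, id]
    refine ⟨?_, ?_⟩ <;> first | rfl | trivial
  have hstr : s ∘ₗ strandMap τ = strandMap (contract τ x y) := by
    refine LinearMap.ext fun v => funext fun a => ?_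
    change _ = Sum.elim coord (fun _ => 0) (contract τ x y (Sum.inr a)) v
    have e : ∀ (w : Fin j → ℤ) b, kill b w a = if a = b then 0 else w a := by
      intro w b
      change w a + (w b • (-Pi.single b 1) : Fin j → ℤ) a = _
      by_cases h : a = b
      · subst h; simp
      · simp [h]
    change kill x (kill y (strandMap τ v)) a = _
    rw [e, e]
    change (if a = x then 0 else if a = y then 0 else
      Sum.elim coord (fun _ => 0) (τ (Sum.inr a)) v) = _
    unfold contract
    by_cases h1 : a = x
    · simp [h1]
    by_cases h2 : a = y
    · simp [h2]
    simp [h1, h2, hp, hq]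
  refine ⟨opProd cupOp L ∘ₗ (ExteriorAlgebra.map (strandMap (contract τ x y))).toLinearMap ∘ₗ
    opProd capOp ((p, q) :: L'), ⟨L, (p, q) :: L', ?_, ⟨?_, ?_, ?_⟩, .refl _⟩, ?_⟩
  · have : CupRel (contract τ x y) = CupRel τ := by
      funext a b
      refine propext ?_
      unfold CupRel contract
      by_cases h1 : a = x
      · subst h1; simp [hp]
      by_cases h2 : a = y
      · subst h2; simp [hq]
      simp [h1, h2, hp, hq]
    rw [this]; exact hL
  · have : ∀ r ∈ L', r.1 ≠ p ∧ r.1 ≠ q ∧ r.2 ≠ p ∧ r.2 ≠ q := by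
      intro r hr
      have h1 := hL'.2.1 r hr
      have h2 := capRel_symm hτ _ _ h1
      refine ⟨?_, ?_, ?_, ?_⟩ <;> intro h
      · rw [h, CapRel, hp'] at h1; simp at h1
      · rw [h, CapRel, hq'] at h1; simp at h1
      · rw [h, CapRel, hp'] at h2; simp at h2
      · rw [h, CapRel, hq'] at h2; simp at h2
    simp only [List.flatMap_cons, List.cons_append, List.nil_append, List.nodup_cons,
      List.mem_cons, List.mem_flatMap, not_or, not_exists, not_and]
    refine ⟨⟨hpq, fun r hr => ?_⟩, fun r hr => ?_, hL'.1⟩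
    · have := this r hr; simp [this.1.symm, this.2.2.1.symm]
    · have := this r hr; simp [this.2.1.symm, this.2.2.2.symm]
  · intro r hr
    rcases List.mem_cons.1 hr with rfl | hr
    · refine ⟨hpq, ?_⟩
      simp [contract, hp, hq]
    · have h1 := hL'.2.1 r hr
      refine ⟨h1.1, ?_⟩
      have e1 : r.1 ≠ p := by rintro h; rw [h, CapRel, hp'] at h1; simp at h1
      have e2 : r.1 ≠ q := by rintro h; rw [h, CapRel, hq'] at h1; simp at h1
      simp [contract, hp, hq, e1, e2, h1.2]
  · rintro a b ⟨hab, h⟩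
    unfold contract at h
    simp only [reduceCtorEq, or_self, if_false, hp, hq, Sum.inl.injEq] at h
    by_cases h1 : a = p
    · simp only [h1, if_true, Sum.inl.injEq] at h
      simp [h1, h]
    by_cases h2 : a = q
    · simp only [h2, hpq.symm, if_true, if_false, Sum.inl.injEq] at h
      simp [h2, h]
    simp only [h1, h2, if_false] at h
    rcases hL'.2.2 a b ⟨hab, h⟩ with h | h
    · left; simp [h]
    · right; simp [h]
  · have e1 : (capOp x y : Module.End ℤ (Fock j)) * opProd cupOp L ≈±
        opProd cupOp L * capOp x y := by
      apply contract_mul_cupProd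
      intro r hr
      have := hLxy r hr
      simp [coord_single, this.1.symm, this.2.1.symm, this.2.2.1.symm, this.2.2.2.symm]
    have e2 : (capOp x y : Module.End ℤ (Fock j)) ∘ₗ
        (ExteriorAlgebra.map (strandMap τ)).toLinearMap =
        (ExteriorAlgebra.map (strandMap τ)).toLinearMap ∘ₗ capOp p q := by
      unfold capOp
      rw [contract_comp_strand, LinearMap.sub_comp, coord_comp_strandMap, coord_comp_strandMap,
        hp, hq]
      rfl
    have e3 : G ∘ₗ opProd cupOp L ∘ₗ (ExteriorAlgebra.map (strandMap (contract τ x y))).toLinearMap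
        = G ∘ₗ opProd cupOp L ∘ₗ (ExteriorAlgebra.map (strandMap τ)).toLinearMap := by
      have h1 := map_cupProd s id L hsL
      simp only [id, Prod.mk.eta, List.map_id'] at h1
      refine LinearMap.ext fun ψ => ?_
      have h2 := congrArg (fun F => F ((ExteriorAlgebra.map (strandMap τ)).toLinearMap ψ)) h1
      have h3 := congrArg (fun F => F (opProd cupOp L
        ((ExteriorAlgebra.map (strandMap τ)).toLinearMap ψ))) Gs
      rw [← hstr, ← map_comp_strand]
      simp only [LinearMap.comp_apply] at h2 h3 ⊢
      rw [← h2, h3]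
    refine (EqUpToSign.comp (.refl G) (EqUpToSign.comp (.refl _) hf)).trans ?_
    rw [opProd_cons]
    have e4 : G ∘ₗ opProd cupOp L ∘ₗ (ExteriorAlgebra.map (strandMap (contract τ x y))).toLinearMap
        ∘ₗ (capOp p q * opProd capOp L') = G ∘ₗ opProd cupOp L ∘ₗ
          capOp x y ∘ₗ (ExteriorAlgebra.map (strandMap τ)).toLinearMap ∘ₗ opProd capOp L' := by
      have := congrArg (fun F => F ∘ₗ (capOp p q * opProd capOp L')) e3
      simp only [LinearMap.comp_assoc] at this
      rw [this, Module.End.mul_eq_comp, ← LinearMap.comp_assoc (opProd capOp L'), ← e2,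
        LinearMap.comp_assoc (opProd capOp L')]
    rw [e4]
    have e5 := EqUpToSign.comp (.refl G) (EqUpToSign.comp e1
      (.refl ((ExteriorAlgebra.map (strandMap τ)).toLinearMap ∘ₗ opProd capOp L')))
    simpa only [Module.End.mul_eq_comp, LinearMap.comp_assoc] using e5

theorem step {τ : Fin i ⊕ Fin j → Fin i ⊕ Fin j} (hτ : ∀ w, τ (τ w) = w) {x y : Fin j}
    (hxy : x ≠ y) (hx : τ (Sum.inr x) ≠ Sum.inr x) (hy : τ (Sum.inr y) ≠ Sum.inr y)
    (hn : τ (Sum.inr x) ≠ Sum.inr y)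
    {f : Fock i →ₗ[ℤ] Fock j} (hf : Represents τ f) (G : Fock j →ₗ[ℤ] Fock k)
    (Gx : Kills G x)
    (Gy : Kills G y) :
    ∃ g, Represents (contract τ x y) g ∧ G ∘ₗ capOp x y ∘ₗ f ≈± G ∘ₗ g := by
  rcases hy' : τ (Sum.inr y) with q | z
  · rcases hx' : τ (Sum.inr x) with p | z
    · exact step_strand hτ hxy hx' hy' hf G Gx Gy
    · obtain ⟨g, h1, h2⟩ := step_cup hτ hxy.symm hy hx (ne_aux hτ hn) hx' hf G Gy Gx
      refine ⟨g, contract_comm hτ hxy hx hy hn ▸ h1, EqUpToSign.trans ?_ h2⟩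
      exact EqUpToSign.comp (.refl G) (EqUpToSign.comp (capOp_flip x y) (.refl f))
  · exact step_cup hτ hxy hx hy hn hy' hf G Gx Gy

/-- The pairs `(x, partner x)` with `x < partner x`, with increasing left dot `x`. -/
def arcs (partner : Fin n → Option (Fin n)) : List (Fin n × Fin n) :=
  (List.finRange n).filterMap fun x =>
    (partner x).bind fun y => if x < y then some (x, y) else none

/-- The cups of a diagram as pairs (left dot, right dot), from the highest to the lowest diamond of the
standard marking: a cup is higher if its left dot is more to the left. -/
def Diagram.cups (d : Diagram i j) : List (Fin j × Fin j) :=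
  arcs fun x => (d.pair (Sum.inr x)).getRight?

/-- The caps of a diagram as pairs (left dot, right dot), from the highest to the lowest arrow of the
standard marking: a cap is higher if its left dot is more to the right. -/
def Diagram.caps (d : Diagram i j) : List (Fin i × Fin i) :=
  (arcs fun x => (d.pair (Sum.inl x)).getLeft?).reverse

/-- The operator of a diagram with its standard marking: the diamonds of the cups on top, in the
standard order, then the propagating lines, then the arrows of the caps, in the standard order, each
pointing to the right. -/
noncomputable def Diagram.op (d : Diagram i j) : Fock i →ₗ[ℤ] Fock j :=
  opProd cupOp d.cups ∘ₗ (ExteriorAlgebra.map (strandMap d.pair)).toLinearMap ∘ₗ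
    opProd capOp d.caps

theorem mem_arcs (partner : Fin n → Option (Fin n)) (x y : Fin n) :
    (x, y) ∈ arcs partner ↔ partner x = some y ∧ x < y := by
  simp only [arcs, List.mem_filterMap, List.mem_finRange, true_and, Option.bind_eq_some_iff,
    Option.ite_none_right_eq_some, Option.some.injEq, Prod.mk.injEq]
  constructor
  · rintro ⟨a, b, h1, h2, rfl, rfl⟩; exact ⟨h1, h2⟩
  · rintro ⟨h1, h2⟩; exact ⟨x, y, h1, h2, rfl, rfl⟩

theorem enumPairs_arcs (partner : Fin n → Option (Fin n))
    (h : ∀ x y, partner x = some y → partner y = some x) (hne : ∀ x, partner x ≠ some x) :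
    EnumPairs (fun x y => partner x = some y) (arcs partner) := by
  refine ⟨?_, fun p hp => ((mem_arcs _ _ _).1 hp).1, fun x y hxy => ?_⟩
  · rw [List.nodup_flatMap]
    constructor
    · rintro ⟨a, b⟩ hp
      have := ((mem_arcs _ _ _).1 hp).2.ne
      simpa using this
    · unfold arcs
      rw [List.pairwise_filterMap]
      refine (List.nodup_finRange n).imp ?_
      rintro a b hab p hp q hq
      simp only [Option.bind_eq_some_iff, Option.ite_none_right_eq_some, Option.some.injEq] at hp hq
      obtain ⟨a', h1, h2, rfl⟩ := hp
      obtain ⟨b', h3, h4, rfl⟩ := hq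
      have h5 := h _ _ h1
      have h6 := h _ _ h3
      simp only [Function.onFun, List.disjoint_left, List.mem_cons, List.not_mem_nil, or_false]
      rintro z (rfl | rfl) (rfl | rfl)
      · exact hab rfl
      · rw [h6] at h1; obtain rfl := Option.some_injective _ h1; exact absurd h2 h4.asymm
      · rw [h5] at h3; obtain rfl := Option.some_injective _ h3; exact absurd h2 h4.asymm
      · rw [h5] at h6; exact hab (Option.some_injective _ h6)
  · rcases lt_trichotomy x y with h1 | h1 | h1
    · left; exact (mem_arcs _ _ _).2 ⟨hxy, h1⟩
    · subst h1; exact absurd hxy (hne x)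
    · right; exact (mem_arcs _ _ _).2 ⟨h _ _ hxy, h1⟩

theorem Diagram.cupRel_iff (d : Diagram i j) (x y : Fin j) :
    CupRel d.pair x y ↔ d.pair (Sum.inr x) = Sum.inr y := by
  refine ⟨fun h => h.2, fun h => ⟨?_, h⟩⟩
  rintro rfl; exact d.pair_ne _ h

theorem Diagram.capRel_iff (d : Diagram i j) (x y : Fin i) :
    CapRel d.pair x y ↔ d.pair (Sum.inl x) = Sum.inl y := by
  refine ⟨fun h => h.2, fun h => ⟨?_, h⟩⟩
  rintro rfl; exact d.pair_ne _ h

theorem Diagram.enum_cups (d : Diagram i j) : EnumPairs (CupRel d.pair) d.cups := by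
  have : CupRel d.pair = fun x y => (d.pair (Sum.inr x)).getRight? = some y := by
    funext x y
    rw [Sum.getRight?_eq_some_iff]; exact propext (d.cupRel_iff x y)
  rw [this]
  refine enumPairs_arcs _ ?_ ?_
  · intro x y h
    rw [Sum.getRight?_eq_some_iff] at *
    rw [← h, d.pair_pair]
  · intro x h
    rw [Sum.getRight?_eq_some_iff] at h
    exact d.pair_ne _ h

theorem Diagram.enum_caps (d : Diagram i j) : EnumPairs (CapRel d.pair) d.caps := by
  have : CapRel d.pair = fun x y => (d.pair (Sum.inl x)).getLeft? = some y := by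
    funext x y
    rw [Sum.getLeft?_eq_some_iff]; exact propext (d.capRel_iff x y)
  rw [this]
  refine (enumPairs_arcs _ ?_ ?_).perm (List.reverse_perm _).symm
  · intro x y h
    rw [Sum.getLeft?_eq_some_iff] at *
    rw [← h, d.pair_pair]
  · intro x h
    rw [Sum.getLeft?_eq_some_iff] at h
    exact d.pair_ne _ h

def MemPts (L : List (Fin j × Fin j)) (w : Fin i ⊕ Fin j) : Prop :=
  ∃ p ∈ L, w = Sum.inr p.1 ∨ w = Sum.inr p.2

theorem fold (L : List (Fin j × Fin j)) : ∀ (τ : Fin i ⊕ Fin j → Fin i ⊕ Fin j)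
    (f : Fock i →ₗ[ℤ] Fock j) (G : Fock j →ₗ[ℤ] Fock k), (∀ w, τ (τ w) = w) →
    (L.flatMap fun p => [p.1, p.2]).Nodup → (∀ w, MemPts L w → τ w ≠ w) →
    (∀ p ∈ L, Kills G p.1 ∧ Kills G p.2) → Represents τ f →
    (∀ F : Fin i ⊕ Fin j → Prop, (∀ w, F (τ w) = F w) →
      (∀ p ∈ L, F (Sum.inr p.1) = F (Sum.inr p.2)) → (∀ w, ¬ MemPts L w → ¬ F w) → ∀ w, ¬ F w) →
    ∃ τ' g, (∀ w, τ' (τ' w) = w) ∧ Represents τ' g ∧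
      G ∘ₗ opProd capOp L ∘ₗ f ≈± G ∘ₗ g ∧
      (∀ F : Fin i ⊕ Fin j → Prop, (∀ w, F (τ w) = F w) →
        (∀ p ∈ L, F (Sum.inr p.1) = F (Sum.inr p.2)) → ∀ w, F (τ' w) = F w) ∧
      (∀ w, τ' w = w ↔ τ w = w ∨ MemPts L w) := by
  induction L using List.reverseRecOn with
  | nil =>
    intro τ f G hτ _ _ _ hf _
    refine ⟨τ, f, hτ, hf, .refl _, fun F h _ => h, fun w => ?_⟩
    simp [MemPts]
  | append_singleton L p ih =>
    obtain ⟨x, y⟩ := p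
    intro τ f G hτ hnd hal hG hf H
    have hnd' := nodup_cons (((List.perm_append_singleton (x, y) L).flatMap_right _).nodup_iff.1 hnd)
    have hxy := hnd'.1
    have mx : MemPts (i := i) (L ++ [(x, y)]) (Sum.inr x) := ⟨(x, y), by simp, Or.inl rfl⟩
    have my : MemPts (i := i) (L ++ [(x, y)]) (Sum.inr y) := ⟨(x, y), by simp, Or.inr rfl⟩
    have hx := hal _ mx
    have hy := hal _ my
    have nx : ¬ MemPts (i := i) L (Sum.inr x) := by
      rintro ⟨p, hp, h | h⟩
      · exact (hnd'.2.1 p hp).1 (Sum.inr_injective h).symm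
      · exact (hnd'.2.1 p hp).2.2.1 (Sum.inr_injective h).symm
    have ny : ¬ MemPts (i := i) L (Sum.inr y) := by
      rintro ⟨p, hp, h | h⟩
      · exact (hnd'.2.1 p hp).2.1 (Sum.inr_injective h).symm
      · exact (hnd'.2.1 p hp).2.2.2 (Sum.inr_injective h).symm
    have memApp : ∀ w : Fin i ⊕ Fin j, MemPts (L ++ [(x, y)]) w ↔
        MemPts L w ∨ w = Sum.inr x ∨ w = Sum.inr y := by
      intro w
      constructor
      · rintro ⟨p, hp, h⟩
        rcases List.mem_append.1 hp with hp | hp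
        · exact Or.inl ⟨p, hp, h⟩
        · rw [List.mem_singleton] at hp; subst hp; exact Or.inr h
      · rintro (⟨p, hp, h⟩ | h)
        · exact ⟨p, by simp [hp], h⟩
        · exact ⟨(x, y), by simp, h⟩
    have hn : τ (Sum.inr x) ≠ Sum.inr y := by
      intro hn
      have hn' : τ (Sum.inr y) = Sum.inr x := by rw [← hn, hτ]
      refine H (fun w => w = Sum.inr x ∨ w = Sum.inr y) (fun w => propext ?_) ?_ ?_ (Sum.inr x)
        (Or.inl rfl)
      · constructor
        · rintro (h | h)
          · right; rw [← hτ w, h, hn]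
          · left; rw [← hτ w, h, hn']
        · rintro (h | h)
          · right; rw [h, hn]
          · left; rw [h, hn']
      · intro p hp
        rcases List.mem_append.1 hp with hp | hp
        · have := hnd'.2.1 p hp
          simp [this]
        · rw [List.mem_singleton] at hp; subst hp; simp
      · intro w hw
        rw [memApp] at hw
        tauto
    have kx : ∀ z : Fin j, (∀ p ∈ L, p.1 ≠ z ∧ p.2 ≠ z) → Kills G z →
        Kills (G ∘ₗ opProd capOp L) z := by
      intro z hz hk ψ
      have e : (LinearMap.mulLeft ℤ (ExteriorAlgebra.ι ℤ (Pi.single z 1 : Fin j → ℤ)) :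
          Module.End ℤ (Fock j)) * opProd capOp L ≈± opProd capOp L * LinearMap.mulLeft ℤ
          (ExteriorAlgebra.ι ℤ (Pi.single z 1 : Fin j → ℤ)) := by
        apply prod_mul_anticomm
        intro b hb
        obtain ⟨p, hp, rfl⟩ := List.mem_map.1 hb
        refine LinearMap.ext fun χ => ?_
        simp only [Module.End.mul_apply, LinearMap.neg_apply, LinearMap.mulLeft_apply, capOp]
        rw [contractLeft_ι_mul']
        have h1 := hz p hp
        simp [coord_single, h1.1, h1.2]
      have e' := e.symm
      rw [LinearMap.comp_apply]
      rcases e' with h | h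
      · have := congrArg (fun F => F ψ) h
        simp only [Module.End.mul_apply, LinearMap.mulLeft_apply] at this
        rw [this]; exact hk _
      · have := congrArg (fun F => F ψ) h
        simp only [Module.End.mul_apply, LinearMap.mulLeft_apply, LinearMap.neg_apply] at this
        rw [this, map_neg]; exact neg_eq_zero.2 (hk _)
    have hG0 := hG (x, y) (by simp)
    obtain ⟨g0, hg0, e0⟩ := step hτ hxy hx hy hn hf (G ∘ₗ opProd capOp L)
      (kx x (fun p hp => ⟨(hnd'.2.1 p hp).1, (hnd'.2.1 p hp).2.2.1⟩) hG0.1)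
      (kx y (fun p hp => ⟨(hnd'.2.1 p hp).2.1, (hnd'.2.1 p hp).2.2.2⟩) hG0.2)
    have hfix := contract_fixed_iff hτ hxy hn
    have hcol : ∀ F : Fin i ⊕ Fin j → Prop, (∀ w, F (τ w) = F w) →
        F (Sum.inr x) = F (Sum.inr y) → ∀ w, F (contract τ x y w) = F w := by
      intro F h1 h2 w
      unfold contract
      split_ifs with ha hb hc
      · rfl
      · rw [hb, h1, h1, h2]
      · rw [hc, h1, h1, h2]
      · exact h1 w
    obtain ⟨τ', g, h1, h2, h3, h4, h5⟩ := ih (contract τ x y) g0 G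
      (contract_contract hτ hxy hx hy hn) hnd'.2.2
      (fun w hw h => by
        rcases (hfix w).1 h with h | h | h
        · exact hal w ((memApp w).2 (Or.inl hw)) h
        · exact nx (h ▸ hw)
        · exact ny (h ▸ hw))
      (fun p hp => hG p (by simp [hp])) hg0
      (by
        intro F hF hFL hFs
        have hFx : ¬ F (Sum.inr x) := hFs _ nx
        have hFy : ¬ F (Sum.inr y) := hFs _ ny
        have key := H (fun w => if w = Sum.inr x ∨ w = Sum.inr y then F (τ (Sum.inr x)) else F w)
          ?_ ?_ ?_
        · intro w hw
          have := key w
          by_cases h : w = Sum.inr x ∨ w = Sum.inr y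
          · rcases h with rfl | rfl
            · exact hFx hw
            · exact hFy hw
          · rw [if_neg h] at this; exact this hw
        · have huv : F (τ (Sum.inr x)) = F (τ (Sum.inr y)) := by
            have := hF (τ (Sum.inr x))
            unfold contract at this
            rw [if_neg (by simp [hx, hn]), if_pos rfl] at this
            exact this.symm
          have hn' := ne_aux hτ hn
          intro w
          by_cases hwx : w = Sum.inr x
          · subst hwx; rw [if_neg (by simp [hx, hn]), if_pos (Or.inl rfl)]
          by_cases hwy : w = Sum.inr y
          · subst hwy; rw [if_neg (by simp [hy, hn']), if_pos (Or.inr rfl)]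
            exact huv.symm
          rw [if_neg (show ¬ (w = Sum.inr x ∨ w = Sum.inr y) by simp [hwx, hwy])]
          by_cases h1 : τ w = Sum.inr x
          · rw [if_pos (Or.inl h1), ← h1, hτ]
          by_cases h2 : τ w = Sum.inr y
          · rw [if_pos (Or.inr h2), huv, ← h2, hτ]
          rw [if_neg (by simp [h1, h2])]
          have := hF w
          unfold contract at this
          rw [if_neg (by simp [hwx, hwy]), if_neg (by rintro rfl; exact h1 (hτ _)),
            if_neg (by rintro rfl; exact h2 (hτ _))] at this
          exact this
        · intro p hp
          rcases List.mem_append.1 hp with hp | hp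
          · have := hnd'.2.1 p hp
            rw [if_neg (by simp [this]), if_neg (by simp [this])]
            exact hFL p hp
          · rw [List.mem_singleton] at hp; subst hp; simp
        · intro w hw
          rw [memApp] at hw
          push Not at hw
          rw [if_neg (by simp [hw])]
          exact hFs w hw.1)
    refine ⟨τ', g, h1, h2, ?_, ?_, ?_⟩
    · have e1 : opProd capOp (L ++ [(x, y)]) = opProd capOp L * capOp x y := by
        simp [opProd]
      rw [e1]
      exact EqUpToSign.trans e0 h3
    · intro F hF hFL
      exact h4 F (hcol F hF (hFL (x, y) (by simp))) (fun p hp => hFL p (by simp [hp]))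
    · intro w
      rw [h5, hfix, memApp]
      tauto

/-- The operator of a loop-free concatenation is, up to a sign, the composition of the operators. -/
theorem op_comp_op (d₁ : Diagram j k) (d₂ : Diagram i j) (H : NoLoop d₁ d₂) :
    d₁.op ∘ₗ d₂.op ≈± (stack d₁ d₂).op := by
  have hc := d₁.enum_caps
  -- a middle dot lies on a cap of `d₁` or on a propagating line
  have memcap : ∀ m m', d₁.pair (Sum.inl m) = Sum.inl m' → MemPts (i := i) d₁.caps (Sum.inr m) := by
    intro m m' h
    rcases hc.2.2 m m' ((d₁.capRel_iff _ _).2 h) with h | h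
    · exact ⟨_, h, Or.inl rfl⟩
    · exact ⟨_, h, Or.inr rfl⟩
  have notcap : ∀ m t, d₁.pair (Sum.inl m) = Sum.inr t → ¬ MemPts (i := i) d₁.caps (Sum.inr m) := by
    rintro m t h ⟨p, hp, hm | hm⟩
    · have := (hc.2.1 p hp).2
      rw [← Sum.inr_injective hm, h] at this; simp at this
    · have := (capRel_symm d₁.pair_pair _ _ (hc.2.1 p hp)).2
      rw [← Sum.inr_injective hm, h] at this; simp at this
  have colour : ∀ (f : Fin i → Prop) g (h : Fin k → Prop), IsColouring d₁ g h →
      ∀ p ∈ d₁.caps, Sum.elim f g (Sum.inr p.1) = Sum.elim f g (Sum.inr p.2) := by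
    intro f g h hg p hp
    have h1 := (hc.2.1 p hp).2
    have h2 := hg (Sum.inl p.1)
    rw [h1] at h2
    exact h2.symm
  obtain ⟨τ, g, hτ, ⟨L, L', hL, hL', hg⟩, hfold, hcol, hfix⟩ :=
    fold d₁.caps d₂.pair d₂.op (ExteriorAlgebra.map (strandMap d₁.pair)).toLinearMap
      d₂.pair_pair hc.1 (fun w _ => d₂.pair_ne w)
      (by
        have kill : ∀ x y, d₁.pair (Sum.inl x) = Sum.inl y →
            Kills (ExteriorAlgebra.map (strandMap d₁.pair)).toLinearMap x := by
          intro x y h ψ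
          rw [AlgHom.toLinearMap_apply, map_mul, ExteriorAlgebra.map_apply_ι]
          have : strandMap d₁.pair (Pi.single x 1) = 0 := by
            funext q
            change Sum.elim coord (fun _ => 0) (d₁.pair (Sum.inr q)) (Pi.single x (1 : ℤ)) = 0
            rcases hq : d₁.pair (Sum.inr q) with p | p
            · rw [Sum.elim_inl, coord_single, if_neg]
              rintro rfl
              rw [← hq, d₁.pair_pair] at h; simp at h
            · rfl
          rw [this, map_zero, zero_mul]
        intro p hp
        exact ⟨kill _ _ (hc.2.1 p hp).2, kill _ _ (capRel_symm d₁.pair_pair _ _ (hc.2.1 p hp)).2⟩)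
      ⟨_, _, d₂.enum_cups, d₂.enum_caps, .refl _⟩
      (by
        intro F h1 h2 h3
        have hB : ∀ b, F (Sum.inl b) = False := fun b => eq_false (h3 _ (by simp [MemPts]))
        have hS : ∀ m t, d₁.pair (Sum.inl m) = Sum.inr t → F (Sum.inr m) = False :=
          fun m t h => eq_false (h3 _ (notcap m t h))
        have e : ∀ w, Sum.elim (fun _ => False) (fun m => F (Sum.inr m)) w = F w := by
          rintro (b | m)
          · exact (hB b).symm
          · rfl
        have := (noLoop_iff d₁ d₂).1 H (fun m => F (Sum.inr m)) (fun w => by rw [e, e, h1]) ?_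
        · rintro (b | m) h
          · rwa [hB] at h
          · have h4 := congrFun this m
            exact h4.mp h
        · rintro (m | t)
          · rcases h : d₁.pair (Sum.inl m) with m' | t
            · rcases hc.2.2 m m' ((d₁.capRel_iff _ _).2 h) with h | h
              · exact (h2 _ h).symm
              · exact h2 _ h
            · exact (hS m t h).symm
          · rcases h : d₁.pair (Sum.inr t) with m | t'
            · exact hS m t (by rw [← h, d₁.pair_pair])
            · rfl)
  have link : ∀ x y, (∀ f g h, IsColouring d₂ f g → IsColouring d₁ g h →
      (∀ w, Sum.elim f g (τ w) = Sum.elim f g w) → Sum.elim f h x = Sum.elim f h y) →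
      y ≠ x → (stack d₁ d₂).pair x = y := by
    intro x y hxy hne
    have hcl : ∀ f h, IsColouring (stack d₁ d₂) f h → Sum.elim f h x = Sum.elim f h y := by
      intro f h hfh
      obtain ⟨g, h2, h1⟩ := (isColouring_stack d₁ d₂ f h).1 hfh
      exact hxy f g h h2 h1 (hcol _ h2 (colour f g h h1))
    rcases eq_or_eq_pair_of_colour (stack d₁ d₂) x y hcl with h | h
    · exact absurd h hne
    · exact h.symm
  have live : ∀ m t, d₁.pair (Sum.inl m) = Sum.inr t → τ (Sum.inr m) ≠ Sum.inr m := by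
    intro m t h h'
    rcases (hfix _).1 h' with h'' | h''
    · exact d₂.pair_ne _ h''
    · exact notcap m t h h''
  have liveB : ∀ b, τ (Sum.inl b) ≠ Sum.inl b := by
    intro b h'
    rcases (hfix _).1 h' with h'' | h''
    · exact d₂.pair_ne _ h''
    · simp [MemPts] at h''
  have strand : ∀ w m, τ w = Sum.inr m → w ≠ Sum.inr m → ∃ t, d₁.pair (Sum.inl m) = Sum.inr t := by
    intro w m h hne
    rcases h' : d₁.pair (Sum.inl m) with m' | t
    · have := (hfix (Sum.inr m)).2 (Or.inr (memcap m m' h'))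
      rw [← h, hτ] at this
      exact absurd (this.trans h) hne
    · exact ⟨t, rfl⟩
  have s1 : ∀ t s, d₁.pair (Sum.inr t) = Sum.inr s →
      (stack d₁ d₂).pair (Sum.inr t) = Sum.inr s := by
    intro t s h
    refine link _ _ (fun f g h' _ h1 _ => ?_) ?_
    · have := h1 (Sum.inr t); rw [h] at this; exact this.symm
    · intro h2; exact d₁.pair_ne _ (h.trans (congrArg _ (Sum.inr_injective h2)))
  have up : ∀ t m, d₁.pair (Sum.inl m) = Sum.inr t → ∀ g h, IsColouring d₁ g h → h t = g m := by
    intro t m h g h' hg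
    have := hg (Sum.inl m)
    rw [h] at this; exact this
  have s2 : ∀ t m b, d₁.pair (Sum.inl m) = Sum.inr t → τ (Sum.inr m) = Sum.inl b →
      (stack d₁ d₂).pair (Sum.inr t) = Sum.inl b := by
    intro t m b h1 h2
    refine link _ _ (fun f g h' _ hd ht => ?_) (by simp)
    have := ht (Sum.inr m)
    rw [h2] at this
    exact (up t m h1 g h' hd).trans this.symm
  have s3 : ∀ t m m' s, d₁.pair (Sum.inl m) = Sum.inr t → τ (Sum.inr m) = Sum.inr m' →
      d₁.pair (Sum.inl m') = Sum.inr s → m ≠ m' →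
      (stack d₁ d₂).pair (Sum.inr t) = Sum.inr s := by
    intro t m m' s h1 h2 h3 hne
    refine link _ _ (fun f g h' _ hd ht => ?_) ?_
    · have := ht (Sum.inr m)
      rw [h2] at this
      exact (up t m h1 g h' hd).trans (this.symm.trans (up s m' h3 g h' hd).symm)
    · intro h
      replace h3 := h3.trans ((congrArg _ (Sum.inr_injective h)).trans h1.symm)
      have := congrArg d₁.pair h3
      rw [d₁.pair_pair, d₁.pair_pair] at this
      exact hne (Sum.inl_injective this).symm
  have s4 : ∀ p q, τ (Sum.inl p) = Sum.inl q → (stack d₁ d₂).pair (Sum.inl p) = Sum.inl q := by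
    intro p q h
    refine link _ _ (fun f g h' _ hd ht => ?_) ?_
    · have := ht (Sum.inl p)
      rw [h] at this
      exact this.symm
    · intro h2; exact liveB _ (h.trans (congrArg _ (Sum.inl_injective h2)))
  have s5 : ∀ p m t, τ (Sum.inl p) = Sum.inr m → d₁.pair (Sum.inl m) = Sum.inr t →
      (stack d₁ d₂).pair (Sum.inl p) = Sum.inr t := by
    intro p m t h1 h2
    have h3 : τ (Sum.inr m) = Sum.inl p := by rw [← h1, hτ]
    rw [← s2 t m p h2 h3, (stack d₁ d₂).pair_pair]
  have hLs : ∀ p ∈ L, ∃ t t', d₁.pair (Sum.inl p.1) = Sum.inr t ∧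
      d₁.pair (Sum.inl p.2) = Sum.inr t' := by
    intro p hp
    have h1 := hL.2.1 p hp
    have h2 := cupRel_symm hτ _ _ h1
    obtain ⟨t', h3⟩ := strand _ _ h1.2 (by simpa using h1.1)
    obtain ⟨t, h4⟩ := strand _ _ h2.2 (by simpa using h2.1)
    exact ⟨t, t', h4, h3⟩
  obtain ⟨L2, hL2, nd2, m1, m2⟩ : ∃ L2 : List (Fin k × Fin k),
      (ExteriorAlgebra.map (strandMap d₁.pair)).toLinearMap ∘ₗ opProd cupOp L =
        opProd cupOp L2 ∘ₗ (ExteriorAlgebra.map (strandMap d₁.pair)).toLinearMap ∧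
      (L2.flatMap fun p => [p.1, p.2]).Nodup ∧
      (∀ q ∈ L2, ∃ p ∈ L, d₁.pair (Sum.inl p.1) = Sum.inr q.1 ∧
        d₁.pair (Sum.inl p.2) = Sum.inr q.2) ∧
      (∀ p ∈ L, ∃ q ∈ L2, d₁.pair (Sum.inl p.1) = Sum.inr q.1 ∧
        d₁.pair (Sum.inl p.2) = Sum.inr q.2) := by
    rcases isEmpty_or_nonempty (Fin k) with hk | hk
    · have : L = [] := by
        rcases L with _ | ⟨p, L⟩
        · rfl
        · obtain ⟨t, _⟩ := hLs p (by simp); exact hk.elim t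
      subst this
      exact ⟨[], rfl, by simp, by simp, by simp⟩
    · let ren : Fin j → Fin k := fun m => Sum.elim (fun _ => Classical.arbitrary _) id
        (d₁.pair (Sum.inl m))
      have hren : ∀ m t, d₁.pair (Sum.inl m) = Sum.inr t → ren m = t := by
        intro m t h; simp [ren, h]
      have hs : ∀ m t, d₁.pair (Sum.inl m) = Sum.inr t →
          strandMap d₁.pair (Pi.single m 1) = Pi.single (ren m) 1 := by
        intro m t h
        rw [hren m t h]
        funext q
        change Sum.elim coord (fun _ => 0) (d₁.pair (Sum.inr q)) (Pi.single m (1 : ℤ)) = _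
        rcases hq : d₁.pair (Sum.inr q) with p | p
        · rw [Sum.elim_inl, coord_single, Pi.single_apply]
          have : p = m ↔ q = t := by
            constructor
            · rintro rfl
              rw [← hq, d₁.pair_pair] at h; exact Sum.inr_injective h
            · rintro rfl
              rw [← h, d₁.pair_pair] at hq; exact (Sum.inl_injective hq).symm
          simp [this]
        · have : q ≠ t := by
            rintro rfl
            rw [← h, d₁.pair_pair] at hq; simp at hq
          simp [this]
      refine ⟨L.map fun p => (ren p.1, ren p.2), map_cupProd _ ren L ?_, ?_, ?_, ?_⟩
      · intro p hp
        obtain ⟨t, t', h1, h2⟩ := hLs p hp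
        exact ⟨hs _ _ h1, hs _ _ h2⟩
      · have : ((L.map (fun p => (ren p.1, ren p.2))).flatMap fun p => [p.1, p.2]) =
            (L.flatMap fun p => [p.1, p.2]).map ren := by
          rw [List.flatMap_map, List.map_flatMap]; rfl
        rw [this]
        refine List.Nodup.map_on ?_ hL.1
        have : ∀ a ∈ (L.flatMap fun p => [p.1, p.2]), d₁.pair (Sum.inl a) = Sum.inr (ren a) := by
          intro a ha
          obtain ⟨p, hp, ha⟩ := List.mem_flatMap.1 ha
          obtain ⟨t, t', h1, h2⟩ := hLs p hp
          simp only [List.mem_cons, List.not_mem_nil, or_false] at ha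
          rcases ha with rfl | rfl
          · rw [hren _ _ h1, h1]
          · rw [hren _ _ h2, h2]
        intro a ha b hb hab
        have h1 := this a ha
        have h2 := this b hb
        rw [hab, ← h2] at h1
        have := congrArg d₁.pair h1
        rw [d₁.pair_pair, d₁.pair_pair] at this
        exact Sum.inl_injective this
      · intro q hq
        obtain ⟨p, hp, rfl⟩ := List.mem_map.1 hq
        obtain ⟨t, t', h1, h2⟩ := hLs p hp
        exact ⟨p, hp, by rw [h1, hren _ _ h1], by rw [h2, hren _ _ h2]⟩
      · intro p hp
        obtain ⟨t, t', h1, h2⟩ := hLs p hp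
        exact ⟨_, List.mem_map.2 ⟨p, hp, rfl⟩, by rw [h1, hren _ _ h1], by rw [h2, hren _ _ h2]⟩
  have hcup := d₁.enum_cups
  have E1 : EnumPairs (CupRel (stack d₁ d₂).pair) (d₁.cups ++ L2) := by
    refine ⟨?_, ?_, ?_⟩
    · rw [List.flatMap_append, List.nodup_append]
      refine ⟨hcup.1, nd2, ?_⟩
      intro a ha b hb hab
      subst hab
      obtain ⟨p, hp, ha⟩ := List.mem_flatMap.1 ha
      obtain ⟨q, hq, hb⟩ := List.mem_flatMap.1 hb
      obtain ⟨r, _, hr1, hr2⟩ := m1 q hq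
      have c1 := (hcup.2.1 p hp).2
      have c2 := (cupRel_symm d₁.pair_pair _ _ (hcup.2.1 p hp)).2
      simp only [List.mem_cons, List.not_mem_nil, or_false] at ha hb
      have hb' : ∃ m, d₁.pair (Sum.inr a) = Sum.inl m := by
        rcases hb with rfl | rfl
        · exact ⟨r.1, by rw [← hr1, d₁.pair_pair]⟩
        · exact ⟨r.2, by rw [← hr2, d₁.pair_pair]⟩
      obtain ⟨m, hm⟩ := hb'
      rcases ha with rfl | rfl
      · rw [c1] at hm; simp at hm
      · rw [c2] at hm; simp at hm
    · intro p hp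
      rw [Diagram.cupRel_iff]
      rcases List.mem_append.1 hp with hp | hp
      · exact s1 _ _ (hcup.2.1 p hp).2
      · obtain ⟨r, hr, hr1, hr2⟩ := m1 p hp
        have := hL.2.1 r hr
        exact s3 _ _ _ _ hr1 this.2 hr2 this.1
    · intro a b hab
      rw [Diagram.cupRel_iff] at hab
      rcases ha : d₁.pair (Sum.inr a) with m | s
      · have ha' : d₁.pair (Sum.inl m) = Sum.inr a := by rw [← ha, d₁.pair_pair]
        rcases hm : τ (Sum.inr m) with p | m'
        · rw [s2 a m p ha' hm] at hab; simp at hab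
        · have hne : m ≠ m' := by
            rintro rfl; exact live _ _ ha' hm
          obtain ⟨s, hs⟩ := strand _ _ hm (by simpa using hne)
          have h3 := s3 a m m' s ha' hm hs hne
          rw [hab] at h3
          obtain rfl := Sum.inr_injective h3
          rcases hL.2.2 m m' ⟨hne, hm⟩ with h | h
          · obtain ⟨q, hq, hq1, hq2⟩ := m2 _ h
            simp only [ha', hs, Sum.inr.injEq] at hq1 hq2
            left; rw [hq1, hq2]; simp [hq]
          · obtain ⟨q, hq, hq1, hq2⟩ := m2 _ h
            simp only [ha', hs, Sum.inr.injEq] at hq1 hq2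
            right; rw [hq1, hq2]; simp [hq]
      · have h3 := s1 a s ha
        rw [hab] at h3
        obtain rfl := Sum.inr_injective h3
        rcases hcup.2.2 a b ((d₁.cupRel_iff _ _).2 ha) with h | h
        · left; simp [h]
        · right; simp [h]
  have E2 : EnumPairs (CapRel (stack d₁ d₂).pair) L' := by
    have : CapRel (stack d₁ d₂).pair = CapRel τ := by
      funext p q
      refine propext ?_
      rw [Diagram.capRel_iff]
      constructor
      · intro h
        rcases hp : τ (Sum.inl p) with q' | m
        · rw [s4 p q' hp] at h
          obtain rfl := Sum.inl_injective h
          exact ⟨by rintro rfl; exact liveB _ hp, hp⟩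
        · obtain ⟨t, ht⟩ := strand _ _ hp (by simp)
          rw [s5 p m t hp ht] at h; simp at h
      · intro h; exact s4 p q h.2
    rw [this]; exact hL'
  have E3 : strandMap d₁.pair ∘ₗ strandMap τ = strandMap (stack d₁ d₂).pair := by
    refine LinearMap.ext fun v => funext fun t => ?_
    change Sum.elim coord (fun _ => 0) (d₁.pair (Sum.inr t)) (strandMap τ v) =
      Sum.elim coord (fun _ => 0) ((stack d₁ d₂).pair (Sum.inr t)) v
    rcases ht : d₁.pair (Sum.inr t) with m | s
    · have ht' : d₁.pair (Sum.inl m) = Sum.inr t := by rw [← ht, d₁.pair_pair]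
      change Sum.elim coord (fun _ => 0) (τ (Sum.inr m)) v = _
      rcases hm : τ (Sum.inr m) with b | m'
      · rw [s2 t m b ht' hm]; rfl
      · have hne : m ≠ m' := by
          rintro rfl; exact live _ _ ht' hm
        obtain ⟨s, hs⟩ := strand _ _ hm (by simpa using hne)
        rw [s3 t m m' s ht' hm hs hne]; rfl
    · rw [s1 t s ht]; rfl
  have e1 : d₁.op ∘ₗ d₂.op ≈± opProd cupOp d₁.cups ∘ₗ
      (ExteriorAlgebra.map (strandMap d₁.pair)).toLinearMap ∘ₗ g :=
    EqUpToSign.comp (.refl (opProd cupOp d₁.cups)) hfold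
  have e2 : opProd cupOp d₁.cups ∘ₗ (ExteriorAlgebra.map (strandMap d₁.pair)).toLinearMap ∘ₗ g ≈±
      opProd cupOp (d₁.cups ++ L2) ∘ₗ
        (ExteriorAlgebra.map (strandMap (stack d₁ d₂).pair)).toLinearMap ∘ₗ opProd capOp L' := by
    refine (EqUpToSign.comp (.refl _) (EqUpToSign.comp (.refl _) hg)).trans ?_
    left
    have : opProd cupOp (d₁.cups ++ L2) = opProd cupOp d₁.cups ∘ₗ opProd cupOp L2 := by
      simp [opProd, Module.End.mul_eq_comp]
    rw [this, ← E3, ← map_comp_strand]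
    refine LinearMap.ext fun ψ => ?_
    have h := congrArg (fun F => F ((ExteriorAlgebra.map (strandMap τ)).toLinearMap
      (opProd capOp L' ψ))) hL2
    simp only [LinearMap.comp_apply] at h ⊢
    rw [h]
  refine e1.trans (e2.trans ?_)
  refine EqUpToSign.comp ?_ (EqUpToSign.comp (.refl _) ?_)
  · exact EnumPairs.unique cupOp cupOp_anti cupOp_flip _ _
      (cupRel_symm (stack d₁ d₂).pair_pair) _ E1 (stack d₁ d₂).enum_cups
  · exact EnumPairs.unique capOp capOp_anti capOp_flip _ _
      (capRel_symm (stack d₁ d₂).pair_pair) _ E2 (stack d₁ d₂).enum_caps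

theorem exists_capProd_eq (L : List (Fin n × Fin n)) : (L.flatMap fun p => [p.1, p.2]).Nodup →
    ∀ ψ : Fock n, (∀ p ∈ L, capOp p.1 p.2 ψ = 0) → ∃ v, opProd capOp L v = ψ := by
  induction L with
  | nil => intro _ ψ _; exact ⟨ψ, by simp [opProd]⟩
  | cons p L ih =>
    obtain ⟨x, y⟩ := p
    intro hnd ψ hψ
    have h := nodup_cons hnd
    obtain ⟨v, hv⟩ := ih h.2.2 (ExteriorAlgebra.ι ℤ (Pi.single y 1) * ψ) (by
      intro q hq
      have h1 := h.2.1 q hq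
      have h2 := hψ q (by simp [hq])
      simp only [capOp] at h2 ⊢
      rw [contractLeft_ι_mul', h2]
      simp [coord_single, h1])
    refine ⟨v, ?_⟩
    have h2 := hψ (x, y) (by simp)
    simp only [capOp] at h2
    rw [opProd_cons, Module.End.mul_apply, hv, capOp, contractLeft_ι_mul', h2]
    simp [coord_single, h.1]

theorem exists_cupProd_inv (L : List (Fin n × Fin n)) : (L.flatMap fun p => [p.1, p.2]).Nodup →
    ∃ E : Module.End ℤ (Fock n), E (opProd cupOp L 1) = 1 := by
  induction L with
  | nil => intro _; exact ⟨1, by simp [opProd]⟩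
  | cons p L ih =>
    obtain ⟨x, y⟩ := p
    intro hnd
    have h := nodup_cons hnd
    obtain ⟨E, hE⟩ := ih h.2.2
    refine ⟨E ∘ₗ CliffordAlgebra.contractLeft (coord x), ?_⟩
    have h0 : CliffordAlgebra.contractLeft (coord x) (opProd cupOp L (1 : Fock n)) = 0 := by
      have key := contract_mul_cupProd (coord x) L (by
        intro q hq
        have h1 := h.2.1 q hq
        simp [coord_single, Ne.symm h1.1, Ne.symm h1.2.2.1])
      have h1 : CliffordAlgebra.contractLeft (coord x) (1 : Fock n) = 0 :=
        CliffordAlgebra.contractLeft_one (Q := 0) _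
      rcases key with key | key
      · have := congrArg (fun F => F 1) key
        simp only [Module.End.mul_apply, h1, map_zero] at this
        exact this
      · have := congrArg (fun F => F 1) key
        simp only [Module.End.mul_apply, h1, map_zero, LinearMap.neg_apply, neg_zero] at this
        exact this
    rw [opProd_cons, LinearMap.comp_apply, Module.End.mul_apply]
    simp only [cupOp, LinearMap.mulLeft_apply]
    rw [contractLeft_ι_mul', h0]
    simp [coord_single, h.1, hE]

/-- The operator of a diagram determines signs. -/
theorem Diagram.op_ne_neg (d : Diagram i j) : d.op ≠ -d.op := by
  intro H
  obtain ⟨v, hv⟩ := exists_capProd_eq d.caps d.enum_caps.1 1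
    (fun p _ => CliffordAlgebra.contractLeft_one (Q := 0) _)
  obtain ⟨E, hE⟩ := exists_cupProd_inv d.cups d.enum_cups.1
  have h1 : E (d.op v) = 1 := by
    simp only [Diagram.op, LinearMap.comp_apply, hv, AlgHom.toLinearMap_apply, map_one, hE]
  have h2 := congrArg (fun F => E (F v)) H
  simp only [LinearMap.neg_apply, map_neg, h1] at h2
  have h3 := congrArg (ExteriorAlgebra.algebraMapInv : Fock j →ₐ[ℤ] ℤ) h2
  rw [map_neg, map_one] at h3
  norm_num at h3

open Classical in
/-- The sign `(-1) ^ γ(d₁, d₂)` of a concatenation without loops. The number `γ(d₁, d₂)` is found by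
giving `d₁` and `d₂` their standard markings, which decorates the picture of `d₁` on top of `d₂`, and
by turning this decoration into the standard marking of `stack d₁ d₂`, where the following operations
count `1` modulo `2`:

* the latitudes of two neighbouring markings are exchanged;
* an arrow is reversed;
* an arrow and a diamond which follow each other on a line and have neighbouring latitudes are
  cancelled, the arrow pointing away from the diamond

(cancelling them counts `0` if the arrow points towards the diamond).

All these operations are identities between the corresponding operators: odd operators on disjoint
lines anticommute (`cupOp_anti`, `capOp_anti`, `contract_mul_cup`), reversing an arrow changes the
sign (`capOp_swap`), and an arrow that points to a diamond directly below it cancels with it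
(`step_cup`). Hence `d₁.op ∘ d₂.op = (-1) ^ γ(d₁, d₂) • (stack d₁ d₂).op` (`op_comp`). Since
`(stack d₁ d₂).op` differs from its negative (`Diagram.op_ne_neg`), this equation pins down the
sign, and it is read off here. -/
noncomputable def sign (d₁ : Diagram j k) (d₂ : Diagram i j) : ℤ :=
  if d₁.op ∘ₗ d₂.op = (stack d₁ d₂).op then 1 else -1

theorem op_comp (d₁ : Diagram j k) (d₂ : Diagram i j) (H : NoLoop d₁ d₂) :
    d₁.op ∘ₗ d₂.op = sign d₁ d₂ • (stack d₁ d₂).op := by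
  unfold sign
  split_ifs with h
  · rw [h, one_smul]
  · rcases op_comp_op d₁ d₂ H with h' | h'
    · exact absurd h' h
    · rw [h', neg_one_smul]

theorem sign_eq_or (d₁ : Diagram j k) (d₂ : Diagram i j) :
    sign d₁ d₂ = 1 ∨ sign d₁ d₂ = -1 := by
  unfold sign; split_ifs <;> simp

/-- The signs satisfy the cocycle identity. -/
theorem sign_assoc (d₁ : Diagram k l) (d₂ : Diagram j k) (d₃ : Diagram i j) (h : NoLoop d₁ d₂)
    (h' : NoLoop (stack d₁ d₂) d₃) :
    sign d₁ d₂ * sign (stack d₁ d₂) d₃ = sign d₂ d₃ * sign d₁ (stack d₂ d₃) := by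
  obtain ⟨g, g'⟩ := (noLoop_assoc d₁ d₂ d₃).1 ⟨h, h'⟩
  have e1 : (d₁.op ∘ₗ d₂.op) ∘ₗ d₃.op =
      (sign d₁ d₂ * sign (stack d₁ d₂) d₃) • (stack (stack d₁ d₂) d₃).op := by
    rw [op_comp _ _ h, LinearMap.smul_comp, op_comp _ _ h', smul_smul]
  have e2 : d₁.op ∘ₗ d₂.op ∘ₗ d₃.op =
      (sign d₂ d₃ * sign d₁ (stack d₂ d₃)) • (stack d₁ (stack d₂ d₃)).op := by
    rw [op_comp _ _ g, LinearMap.comp_smul, op_comp _ _ g', smul_smul]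
  rw [LinearMap.comp_assoc, e2, stack_assoc] at e1
  have hne := (stack d₁ (stack d₂ d₃)).op_ne_neg
  rcases sign_eq_or d₁ d₂ with a | a <;> rcases sign_eq_or (stack d₁ d₂) d₃ with b | b <;>
  rcases sign_eq_or d₂ d₃ with c | c <;> rcases sign_eq_or d₁ (stack d₂ d₃) with d | d <;>
  rw [a, b, c, d] at e1 ⊢ <;> norm_num at e1 ⊢
  all_goals first | exact hne e1 | exact hne e1.symm

/-- The identity diagram: `n` vertical propagating lines. -/
def idDiagram (n : ℕ) : Diagram n n where
  pair := Sum.swap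
  pair_pair := Sum.swap_swap
  pair_ne := by rintro (x | x) h <;> simp at h

theorem idDiagram_op (n : ℕ) : (idDiagram n).op = LinearMap.id := by
  have h1 : (idDiagram n).cups = [] := by
    simp [Diagram.cups, arcs, idDiagram]
  have h2 : (idDiagram n).caps = [] := by
    simp [Diagram.caps, arcs, idDiagram]
  have h3 : strandMap (idDiagram n).pair = LinearMap.id := rfl
  rw [Diagram.op, h1, h2, h3]
  refine LinearMap.ext fun ψ => ?_
  simp [opProd]

theorem stack_id (d : Diagram i j) : stack d (idDiagram i) = d := by
  refine stack_eq_of_joined _ _ _ ?_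
  have e : ∀ x : Fin i ⊕ Fin j, Joined d (idDiagram i) (outerDot i x) (upperDot i x) := by
    rintro (x | x)
    · exact joined_lower d (idDiagram i) (Sum.inl x)
    · exact .refl _
  exact fun x => (e x).trans ((joined_upper d (idDiagram i) x).trans (e _).symm)

theorem id_stack (d : Diagram i j) : stack (idDiagram j) d = d := by
  refine stack_eq_of_joined _ _ _ ?_
  have e : ∀ x : Fin i ⊕ Fin j, Joined (idDiagram j) d (outerDot j x) (lowerDot j x) := by
    rintro (x | x)
    · exact .refl _
    · exact joined_upper (idDiagram j) d (Sum.inr x)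
  exact fun x => (e x).trans ((joined_lower (idDiagram j) d x).trans (e _).symm)

theorem noLoop_id (d : Diagram i j) : NoLoop d (idDiagram i) := fun m =>
  ⟨Sum.inl m, joined_lower d (idDiagram i) (Sum.inr m)⟩

theorem id_noLoop (d : Diagram i j) : NoLoop (idDiagram j) d := fun m =>
  ⟨Sum.inr m, joined_upper (idDiagram j) d (Sum.inl m)⟩

theorem sign_id (d : Diagram i j) : sign d (idDiagram i) = 1 := by
  rw [sign, if_pos]; rw [idDiagram_op, stack_id, LinearMap.comp_id]

theorem id_sign (d : Diagram i j) : sign (idDiagram j) d = 1 := by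
  rw [sign, if_pos]; rw [idDiagram_op, id_stack, LinearMap.id_comp]

/-! ### The periplectic Brauer category -/

section HomSpaces
variable (𝕜 : Type u) [Field 𝕜]

open Classical in
/-- The composition `d₁ ∘ d₂` of two basis morphisms: `0` if the picture contains a closed loop, and
`(-1) ^ γ(d₁, d₂) d₁ ∗ d₂` otherwise. -/
noncomputable def diagramComp (d₁ : Diagram j k) (d₂ : Diagram i j) : Diagram i k →₀ 𝕜 :=
  if NoLoop d₁ d₂ then Finsupp.single (stack d₁ d₂) (sign d₁ d₂ : 𝕜) else 0

/-- The bilinear extension of the composition of diagrams, `compBilin f g = f ∘ g`. -/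
noncomputable def compBilin :
    (Diagram j k →₀ 𝕜) →ₗ[𝕜] (Diagram i j →₀ 𝕜) →ₗ[𝕜] (Diagram i k →₀ 𝕜) :=
  Finsupp.lift _ 𝕜 _ fun d₁ => Finsupp.lift _ 𝕜 _ fun d₂ => diagramComp 𝕜 d₁ d₂

theorem compBilin_single (d₁ : Diagram j k) (d₂ : Diagram i j) (a b : 𝕜) :
    compBilin 𝕜 (Finsupp.single d₁ a) (Finsupp.single d₂ b) = (a * b) • diagramComp 𝕜 d₁ d₂ := by
  simp [compBilin, mul_smul]

open Classical in
theorem compBilin_assoc (f : Diagram k l →₀ 𝕜) (g : Diagram j k →₀ 𝕜) (h : Diagram i j →₀ 𝕜) :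
    compBilin 𝕜 (compBilin 𝕜 f g) h = compBilin 𝕜 f (compBilin 𝕜 g h) := by
  induction f using Finsupp.induction_linear with
  | zero => simp
  | add f f' h1 h2 => simp only [map_add, LinearMap.add_apply, h1, h2]
  | single d₁ a =>
  induction g using Finsupp.induction_linear with
  | zero => simp
  | add f f' h1 h2 => simp only [map_add, LinearMap.add_apply, h1, h2]
  | single d₂ b =>
  induction h using Finsupp.induction_linear with
  | zero => simp
  | add f f' h1 h2 => simp only [map_add, h1, h2]
  | single d₃ c =>
    rw [compBilin_single, compBilin_single, map_smul, map_smul, LinearMap.smul_apply]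
    have e1 : compBilin 𝕜 (diagramComp 𝕜 d₁ d₂) (Finsupp.single d₃ c) =
        c • compBilin 𝕜 (diagramComp 𝕜 d₁ d₂) (Finsupp.single d₃ 1) := by
      rw [← map_smul, Finsupp.smul_single_one]
    have e2 : compBilin 𝕜 (Finsupp.single d₁ a) (diagramComp 𝕜 d₂ d₃) =
        a • compBilin 𝕜 (Finsupp.single d₁ 1) (diagramComp 𝕜 d₂ d₃) := by
      rw [← LinearMap.smul_apply, ← map_smul, Finsupp.smul_single_one]
    rw [e1, e2, smul_smul, smul_smul]
    have key : compBilin 𝕜 (diagramComp 𝕜 d₁ d₂) (Finsupp.single d₃ 1) =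
        compBilin 𝕜 (Finsupp.single d₁ 1) (diagramComp 𝕜 d₂ d₃) := by
      have hl : compBilin 𝕜 (diagramComp 𝕜 d₁ d₂) (Finsupp.single d₃ 1) =
          if NoLoop d₁ d₂ ∧ NoLoop (stack d₁ d₂) d₃ then Finsupp.single (stack (stack d₁ d₂) d₃)
            ((sign d₁ d₂ * sign (stack d₁ d₂) d₃ : ℤ) : 𝕜) else 0 := by
        rw [diagramComp]
        by_cases h1 : NoLoop d₁ d₂
        · rw [if_pos h1, compBilin_single, diagramComp]
          by_cases h2 : NoLoop (stack d₁ d₂) d₃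
          · simp [h1, h2]
          · simp [h2]
        · simp [h1]
      have hr : compBilin 𝕜 (Finsupp.single d₁ 1) (diagramComp 𝕜 d₂ d₃) =
          if NoLoop d₂ d₃ ∧ NoLoop d₁ (stack d₂ d₃) then Finsupp.single (stack d₁ (stack d₂ d₃))
            ((sign d₂ d₃ * sign d₁ (stack d₂ d₃) : ℤ) : 𝕜) else 0 := by
        rw [diagramComp]
        by_cases h1 : NoLoop d₂ d₃
        · rw [if_pos h1, compBilin_single, diagramComp]
          by_cases h2 : NoLoop d₁ (stack d₂ d₃)
          · simp [h1, h2]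
          · simp [h2]
        · simp [h1]
      rw [hl, hr]
      by_cases H : NoLoop d₁ d₂ ∧ NoLoop (stack d₁ d₂) d₃
      · rw [if_pos H, if_pos ((noLoop_assoc _ _ _).1 H), stack_assoc, sign_assoc _ _ _ H.1 H.2]
      · rw [if_neg H, if_neg fun h => H ((noLoop_assoc _ _ _).2 h)]
    rw [key, show a * b * c = b * c * a by ring]

theorem compBilin_id (f : Diagram i j →₀ 𝕜) :
    compBilin 𝕜 f (Finsupp.single (idDiagram i) 1) = f := by
  induction f using Finsupp.induction_linear with
  | zero => simp
  | add f f' h1 h2 => simp only [map_add, LinearMap.add_apply, h1, h2]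
  | single d a => simp [compBilin_single, diagramComp, noLoop_id, stack_id, sign_id]

theorem id_compBilin (f : Diagram i j →₀ 𝕜) :
    compBilin 𝕜 (Finsupp.single (idDiagram j) 1) f = f := by
  induction f using Finsupp.induction_linear with
  | zero => simp
  | add f f' h1 h2 => simp only [map_add, h1, h2]
  | single d a => simp [compBilin_single, diagramComp, id_noLoop, id_stack, id_sign]

end HomSpaces

/-- The objects of the periplectic Brauer category over `𝕜` are the natural numbers. -/
structure BrauerCategory (𝕜 : Type u) where
  rank : ℕ

variable (𝕜 : Type u) [Field 𝕜]

/-- Morphisms from `i` to `j` are the formal linear combinations of `(i, j)`-Brauer diagrams. In the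
order of composition of Mathlib, `f ≫ g` is `g ∘ f`. -/
noncomputable instance : Category (BrauerCategory 𝕜) where
  Hom i j := Diagram i.rank j.rank →₀ 𝕜
  id i := Finsupp.single (idDiagram i.rank) 1
  comp f g := compBilin 𝕜 g f
  id_comp f := compBilin_id 𝕜 f
  comp_id f := id_compBilin 𝕜 f
  assoc f g h := (compBilin_assoc 𝕜 h g f).symm

noncomputable instance : Preadditive (BrauerCategory 𝕜) where
  homGroup i j := inferInstanceAs (AddCommGroup (Diagram i.rank j.rank →₀ 𝕜))
  add_comp _ _ _ f f' g := LinearMap.map_add (compBilin 𝕜 g) f f'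
  comp_add _ _ _ f g g' := LinearMap.map_add₂ (compBilin 𝕜) g g' f

noncomputable instance : Linear 𝕜 (BrauerCategory 𝕜) where
  homModule i j := inferInstanceAs (Module 𝕜 (Diagram i.rank j.rank →₀ 𝕜))
  smul_comp _ _ _ r f g := LinearMap.map_smul (compBilin 𝕜 g) r f
  comp_smul _ _ _ f r g := LinearMap.map_smul₂ (compBilin 𝕜) r g f

/-! ### The algebras and the bimodule -/

/-- The periplectic Brauer algebra `A_n`, with product `a * b = a ∘ b`. -/
abbrev A (n : ℕ) : Type u := End (BrauerCategory.mk n : BrauerCategory 𝕜)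

/-- The set `{n - 2 i | 0 ≤ i ≤ n / 2}`. -/
def J (n : ℕ) : Finset ℕ := (Finset.range (n / 2 + 1)).image fun i => n - 2 * i

/-- The algebra `C_n`, the direct sum of the spaces of morphisms from `i` to `j` with `i` and `j` in
`J n`. An element is the family of its components, `x i j` being the one from `i` to `j`. -/
def C (n : ℕ) : Type u := (i j : J n) → ((⟨i⟩ : BrauerCategory 𝕜) ⟶ ⟨j⟩)

namespace C
variable {𝕜}

noncomputable instance : AddCommGroup (C 𝕜 n) :=
  inferInstanceAs (AddCommGroup ((i j : J n) → ((⟨i⟩ : BrauerCategory 𝕜) ⟶ ⟨j⟩)))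

noncomputable instance : Module 𝕜 (C 𝕜 n) :=
  inferInstanceAs (Module 𝕜 ((i j : J n) → ((⟨i⟩ : BrauerCategory 𝕜) ⟶ ⟨j⟩)))

/-- The product is composition, `x * y = x ∘ y`, where non-composable morphisms have product `0`. -/
noncomputable instance : Mul (C 𝕜 n) where
  mul x y := fun i j => ∑ r, y i r ≫ x r j

noncomputable instance : One (C 𝕜 n) where
  one := fun i => Pi.single (M := fun j : J n => ((⟨i⟩ : BrauerCategory 𝕜) ⟶ ⟨j⟩)) i (𝟙 _)

theorem mul_apply (x y : C 𝕜 n) (i j : J n) : (x * y) i j = ∑ r, y i r ≫ x r j := rfl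
theorem add_apply (x y : C 𝕜 n) (i j : J n) : (x + y) i j = x i j + y i j := rfl
theorem zero_apply (i j : J n) : (0 : C 𝕜 n) i j = 0 := rfl
theorem smul_apply (r : 𝕜) (x : C 𝕜 n) (i j : J n) : (r • x) i j = r • x i j := rfl
theorem one_apply (i : J n) : (1 : C 𝕜 n) i =
    Pi.single (M := fun j : J n => ((⟨i⟩ : BrauerCategory 𝕜) ⟶ ⟨j⟩)) i (𝟙 _) := rfl

theorem ext' {x y : C 𝕜 n} (h : ∀ i j, x i j = y i j) : x = y := funext fun i => funext (h i)

noncomputable instance : Ring (C 𝕜 n) where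
  zero_mul x := ext' fun i j => by simp [mul_apply, zero_apply]
  mul_zero x := ext' fun i j => by simp [mul_apply, zero_apply]
  left_distrib x y z := ext' fun i j => by
    simp [mul_apply, add_apply, Finset.sum_add_distrib]
  right_distrib x y z := ext' fun i j => by
    simp [mul_apply, add_apply, Finset.sum_add_distrib]
  one_mul x := ext' fun i j => by
    rw [mul_apply, Finset.sum_eq_single j]
    · rw [one_apply, Pi.single_eq_same, Category.comp_id]
    · intro r _ h
      rw [one_apply, Pi.single_eq_of_ne h.symm, Limits.comp_zero]
    · simp
  mul_one x := ext' fun i j => by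
    rw [mul_apply, Finset.sum_eq_single i]
    · rw [one_apply, Pi.single_eq_same, Category.id_comp]
    · intro r _ h
      rw [one_apply, Pi.single_eq_of_ne h, Limits.zero_comp]
    · simp
  mul_assoc x y z := ext' fun i j => by
    simp only [mul_apply, Preadditive.comp_sum, Preadditive.sum_comp, Category.assoc]
    exact Finset.sum_comm
  neg_add_cancel := neg_add_cancel
  sub_eq_add_neg := sub_eq_add_neg
  zsmul := fun z x => z • x
  zsmul_zero' := SubNegMonoid.zsmul_zero'
  zsmul_succ' := SubNegMonoid.zsmul_succ'
  zsmul_neg' := SubNegMonoid.zsmul_neg'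

noncomputable instance : Algebra 𝕜 (C 𝕜 n) :=
  Algebra.ofModule
    (fun r x y => ext' fun i j => by
      simp [mul_apply, smul_apply, Finset.smul_sum])
    (fun r x y => ext' fun i j => by
      simp [mul_apply, smul_apply, Finset.smul_sum])

end C

theorem self_mem_J (n : ℕ) : n ∈ J n := Finset.mem_image.2 ⟨0, by simp, by simp⟩

variable {𝕜}

/-- The inclusion of `A_n`, the space of morphisms from `n` to `n`, into `C_n`. -/
noncomputable def corner (a : A 𝕜 n) : C 𝕜 n :=
  Pi.single ⟨n, self_mem_J n⟩ (Pi.single ⟨n, self_mem_J n⟩ a)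

/-- The idempotent `e_n ^ *` of `C_n`: the identity morphism of the object `n`. -/
noncomputable def eStar (𝕜 : Type u) [Field 𝕜] (n : ℕ) : C 𝕜 n := corner 1

/-- The right ideal `X = e_n ^ * C_n` of `C_n`; right modules are modules over the opposite ring. -/
noncomputable def X (𝕜 : Type u) [Field 𝕜] (n : ℕ) : Submodule (C 𝕜 n)ᵐᵒᵖ (C 𝕜 n) where
  carrier := Set.range fun c => eStar 𝕜 n * c
  add_mem' := by
    rintro _ _ ⟨c, rfl⟩ ⟨d, rfl⟩; exact ⟨c + d, mul_add _ _ _⟩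
  zero_mem' := ⟨0, mul_zero _⟩
  smul_mem' := by
    rintro r _ ⟨c, rfl⟩; exact ⟨c * r.unop, (mul_assoc _ _ _).symm⟩

theorem corner_apply (a : A 𝕜 n) : corner a ⟨n, self_mem_J n⟩ ⟨n, self_mem_J n⟩ = a := by
  rw [corner, Pi.single_eq_same, Pi.single_eq_same]

theorem corner_apply_of_ne (a : A 𝕜 n) (i j : J n) (h : i ≠ ⟨n, self_mem_J n⟩) :
    corner a i j = 0 := by
  rw [corner, Pi.single_eq_of_ne h]; rfl

theorem corner_apply_of_ne' (a : A 𝕜 n) (i j : J n) (h : j ≠ ⟨n, self_mem_J n⟩) :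
    corner a i j = 0 := by
  by_cases hi : i = ⟨n, self_mem_J n⟩
  · subst hi; rw [corner, Pi.single_eq_same, Pi.single_eq_of_ne h]
  · exact corner_apply_of_ne a i j hi

theorem corner_mul (a b : A 𝕜 n) : corner (a * b) = corner a * corner b := by
  refine C.ext' fun i j => ?_
  rw [C.mul_apply, Finset.sum_eq_single ⟨n, self_mem_J n⟩]
  · by_cases hi : i = ⟨n, self_mem_J n⟩
    · by_cases hj : j = ⟨n, self_mem_J n⟩
      · subst hi hj; rw [corner_apply, corner_apply, corner_apply]; rfl
      · rw [corner_apply_of_ne' _ _ _ hj, corner_apply_of_ne' _ _ _ hj, Limits.comp_zero]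
    · rw [corner_apply_of_ne _ _ _ hi, corner_apply_of_ne _ _ _ hi, Limits.zero_comp]
  · intro r _ h
    rw [corner_apply_of_ne _ _ _ h, Limits.comp_zero]
  · simp

theorem corner_add (a b : A 𝕜 n) : corner (a + b) = corner a + corner b := by
  unfold corner; rw [Pi.single_add, Pi.single_add]; rfl

theorem corner_zero : corner (0 : A 𝕜 n) = 0 := by
  unfold corner; rw [Pi.single_zero, Pi.single_zero]; rfl

theorem corner_smul (r : 𝕜) (a : A 𝕜 n) : corner (r • a) = r • corner a := by
  unfold corner; rw [Pi.single_smul, Pi.single_smul]; rfl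

theorem e_mul_of_mem {x : C 𝕜 n} (hx : x ∈ X 𝕜 n) : eStar 𝕜 n * x = x := by
  obtain ⟨c, rfl⟩ := hx
  change eStar 𝕜 n * (eStar 𝕜 n * c) = eStar 𝕜 n * c
  rw [← mul_assoc, eStar, ← corner_mul, one_mul]

theorem corner_mul_mem (a : A 𝕜 n) {x : C 𝕜 n} : corner a * x ∈ X 𝕜 n :=
  ⟨corner a * x, by
    change eStar 𝕜 n * (corner a * x) = corner a * x
    rw [← mul_assoc, eStar, ← corner_mul, one_mul]⟩

/-- The algebra `A_n = e_n ^ * C_n e_n ^ *` acts on `X` by multiplication in `C_n` from the left. -/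
noncomputable instance : Module (A 𝕜 n) (X 𝕜 n) where
  smul a x := ⟨corner a * (x : C 𝕜 n), corner_mul_mem a⟩
  one_smul x := Subtype.ext (e_mul_of_mem x.2)
  mul_smul a b x := Subtype.ext (by
    change corner (a * b) * (x : C 𝕜 n) = corner a * (corner b * x)
    rw [corner_mul, mul_assoc])
  smul_zero a := Subtype.ext (mul_zero _)
  smul_add a x y := Subtype.ext (mul_add _ _ _)
  add_smul a b x := Subtype.ext (by
    change corner (a + b) * (x : C 𝕜 n) = corner a * (x : C 𝕜 n) + corner b * x
    rw [corner_add, add_mul])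
  zero_smul x := Subtype.ext (by
    change corner 0 * (x : C 𝕜 n) = 0
    rw [corner_zero, zero_mul])

instance : IsScalarTower 𝕜 (C 𝕜 n)ᵐᵒᵖ (C 𝕜 n) where
  smul_assoc r c x := by
    change x * (r • c.unop) = r • (x * c.unop)
    rw [mul_smul_comm]

instance : IsScalarTower 𝕜 (C 𝕜 n)ᵐᵒᵖ (X 𝕜 n) where
  smul_assoc r c x := Subtype.ext (by
    change (x : C 𝕜 n) * (r • c.unop) = r • ((x : C 𝕜 n) * c.unop)
    rw [mul_smul_comm])

instance : IsScalarTower 𝕜 (A 𝕜 n) (X 𝕜 n) where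
  smul_assoc r a x := Subtype.ext (by
    change corner (r • a) * (x : C 𝕜 n) = r • (corner a * (x : C 𝕜 n))
    rw [corner_smul, smul_mul_assoc])

instance : SMulCommClass 𝕜 (A 𝕜 n) (X 𝕜 n) where
  smul_comm r a x := Subtype.ext (by
    change r • (corner a * (x : C 𝕜 n)) = corner a * (r • (x : C 𝕜 n))
    rw [mul_smul_comm])

instance : SMulCommClass 𝕜 (C 𝕜 n)ᵐᵒᵖ (X 𝕜 n) where
  smul_comm r c x := Subtype.ext (by
    change r • ((x : C 𝕜 n) * c.unop) = (r • (x : C 𝕜 n)) * c.unop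
    rw [smul_mul_assoc])

instance : SMulCommClass (A 𝕜 n) (C 𝕜 n)ᵐᵒᵖ (X 𝕜 n) where
  smul_comm a c x := Subtype.ext (by
    change corner a * ((x : C 𝕜 n) * c.unop) = (corner a * (x : C 𝕜 n)) * c.unop
    rw [mul_assoc])

end PeriplecticBrauer

/-! The bimodule `X` is the sum of the spaces Hom(i, n) with i in J(n), on which A_n = End(n) acts
by composition at the target and C_n acts by composition at the source, like a matrix.

The first isomorphism is the general fact End_C(eC) = eCe for an idempotent e: an endomorphism of eC
is determined by the image of the generator e (`lsmul_A_bijective`). This half holds for every n.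

For the second, an A_n-endomorphism of `X` is a matrix of maps F from Hom(i, n) to Hom(k, n) that
commute with composition by endomorphisms of n. It must be shown that each F is precomposition with
exactly one morphism from k to i (`exists_eq_comp`, `eq_zero_of_comp`). If i is a retract of n, say
s ≫ r = 1 with s : i → n and r : n → i, then x = s ≫ (r ≫ x) with r ≫ x in A_n, so F x = (F s ≫ r) ≫
x; likewise c = (c ≫ s) ≫ r is recovered from its composites with morphisms to n. Every positive i
in J(n) is a retract of n, because a cup can be straightened by a cap that shares just one dot with
it (`exists_retract`).

The object 0 needs another argument, since closing a cup by a cap makes a loop, which is zero. Here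
n is even and n > 2, so 2 and 4 are retracts of n. Write u : 0 → 2 for the cup. Every morphism from
0 to n has the form u ≫ y (`exists_cup_comp`), and the retract argument at 2 gives F (u ≫ y) = c ≫ y
for some c : k → 2. As F 0 = 0 and 4 is a retract of n, c ≫ b = 0 for all b : 2 → 4 with u ≫ b = 0.
One such b, the signed difference of the two ways to open a cup in a pair of cups, already forces c
= c' ≫ u (`factors_through_cup`), and then F is precomposition with c'. Uniqueness at 0 follows from
that at 2, since composition with u is injective (`eq_zero_of_comp_noCap`).

No sign is computed: from here on it is enough that the signs are 1 or -1. What makes the diagram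
calculus easy is that nearly all concatenations have an upper diagram without caps, hence no loops,
and that the lower diagram can be read off from the result. -/

namespace PeriplecticBrauer

open CategoryTheory

universe u

variable {i j k n : ℕ}

/-! ### Stacking a diagram without caps -/

/-- The diagram has no caps: every lower dot `x` is joined to the upper dot `f x`. -/
def NoCap (d : Diagram i j) (f : Fin i → Fin j) : Prop :=
  ∀ x, d.pair (Sum.inl x) = Sum.inr (f x)

theorem NoCap.injective {u : Diagram j k} {f : Fin j → Fin k} (hu : NoCap u f) :
    Function.Injective f := by
  intro x y h
  have := congrArg u.pair ((hu x).trans ((congrArg Sum.inr h).trans (hu y).symm))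
  rw [u.pair_pair, u.pair_pair] at this
  exact Sum.inl_injective this

/-- A middle dot runs straight up a propagating line of `u`, so `Sum.map id f` places every dot of
`d` on the boundary without leaving its line. -/
theorem NoCap.joined {u : Diagram j k} {f : Fin j → Fin k} (hu : NoCap u f) (d : Diagram i j)
    (x : Fin i ⊕ Fin j) :
    Joined u d (outerDot j (Sum.map id f x)) (lowerDot k x) := by
  rcases x with x | x
  · exact .refl _
  · have := joined_upper u d (Sum.inl x)
    rw [hu] at this
    exact this.symm

/-- A loop would have to turn back in a cap of `u`. Composites with `u` on top are therefore never
zero for diagrams. -/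
theorem NoCap.noLoop {u : Diagram j k} {f : Fin j → Fin k} (hu : NoCap u f) (d : Diagram i j) :
    NoLoop u d := fun m => ⟨_, (hu.joined d (Sum.inr m)).symm⟩

/-- The concatenation contains a copy of `d`: the lines of `d` are only prolonged upwards, and their
ends stay distinct because `f` is injective. The upper dots outside the range of `f` are the
business of `stack_pair_of_cup`. -/
theorem NoCap.stack_pair {u : Diagram j k} {f : Fin j → Fin k} (hu : NoCap u f)
    (d : Diagram i j) (x : Fin i ⊕ Fin j) :
    (stack u d).pair (Sum.map id f x) = Sum.map id f (d.pair x) := by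
  have h := ((hu.joined d x).trans (joined_lower u d x)).trans (hu.joined d _).symm
  rcases (joined_outer_iff u d _ _).1 h with h | h
  · exact absurd ((Sum.map_injective.2 ⟨Function.injective_id, hu.injective⟩) h) (d.pair_ne x)
  · exact h.symm

/-- A cup of the upper diagram never meets the middle dots, so it survives whatever lies below; `u`
may have caps here. -/
theorem stack_pair_of_cup {u : Diagram j k} {a b : Fin k} (hab : u.pair (Sum.inr a) = Sum.inr b)
    (d : Diagram i j) : (stack u d).pair (Sum.inr a) = Sum.inr b := by
  have h := joined_upper u d (Sum.inr a)
  rw [hab] at h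
  rcases (joined_outer_iff u d (Sum.inr a) (Sum.inr b)).1 h with h | h
  · have e : b = a := Sum.inr_injective h
    exact absurd (hab.trans (congrArg Sum.inr e)) (u.pair_ne _)
  · exact h.symm

/-- `NoCap.stack_pair` recovers `d` from the concatenation. On morphisms this means that composition
with `u` sends basis elements to distinct basis elements, up to signs. -/
theorem NoCap.stack_injective {u : Diagram j k} {f : Fin j → Fin k} (hu : NoCap u f) :
    Function.Injective fun d : Diagram i j => stack u d := by
  intro d d' h
  ext x
  apply (Sum.map_injective.2 ⟨Function.injective_id, hu.injective⟩)
  rw [← hu.stack_pair, ← hu.stack_pair]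
  exact congrArg (fun d : Diagram i k => d.pair (Sum.map id f x)) h

/-- An upper dot lies either on a propagating line of `u`, hence in the range of `f`, or on a cup of
`u`. The two conditions thus determine `d'`, and concatenations can be identified without tracing
lines. -/
theorem NoCap.stack_eq {u : Diagram j k} {f : Fin j → Fin k} (hu : NoCap u f) {d : Diagram i j}
    {d' : Diagram i k} (h : ∀ x, d'.pair (Sum.map id f x) = Sum.map id f (d.pair x))
    (h' : ∀ a b, u.pair (Sum.inr a) = Sum.inr b → d'.pair (Sum.inr a) = Sum.inr b) :
    stack u d = d' := by
  ext x
  rcases x with x | a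
  · exact (hu.stack_pair d (Sum.inl x)).trans (h (Sum.inl x)).symm
  · rcases e : u.pair (Sum.inr a) with y | b
    · have : a = f y := by
        have := congrArg u.pair e
        rw [u.pair_pair, hu] at this
        exact Sum.inr_injective this
      subst this
      exact (hu.stack_pair d (Sum.inr y)).trans (h (Sum.inr y)).symm
    · rw [stack_pair_of_cup e, h' _ _ e]

/-! ### Some diagrams -/

/-- A cup on the first two upper dots, followed by `i` propagating lines. -/
def addCup (i : ℕ) : Diagram i (i + 2) where
  pair := Sum.elim (fun x => Sum.inr x.succ.succ)
    (Fin.cases (Sum.inr 1) (Fin.cases (Sum.inr 0) Sum.inl))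
  pair_pair := by
    rintro (x | x)
    · rfl
    · refine Fin.cases rfl (Fin.cases rfl fun x => rfl) x
  pair_ne := by
    rintro (x | x)
    · exact Sum.inr_ne_inl
    · refine Fin.cases ?_ (Fin.cases ?_ fun x => ?_) x
      · exact fun h => absurd (Sum.inr_injective h) Fin.zero_ne_one.symm
      · exact fun h => absurd (Sum.inr_injective h) Fin.zero_ne_one
      · exact Sum.inl_ne_inr

theorem noCap_addCup (i : ℕ) : NoCap (addCup i) fun x => x.succ.succ := fun _ => rfl

/-- A propagating line, followed by a cap and `p` propagating lines. -/
def straightener (p : ℕ) : Diagram (p + 3) (p + 1) where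
  -- The cap joins the lower dots `1` and `2` (`Fin.succ 1` is the dot `2`). It meets the cup of
  -- `addCup`, on the dots `0` and `1`, in the dot `1` alone; this yields a zigzag instead of a
  -- loop.
  pair := Sum.elim
    (Fin.cases (Sum.inr 0) (Fin.cases (Sum.inl (Fin.succ 1)) (Fin.cases (Sum.inl 1)
      fun x => Sum.inr x.succ)))
    (Fin.cases (Sum.inl 0) fun x => Sum.inl x.succ.succ.succ)
  pair_pair := by
    rintro (x | x)
    · refine Fin.cases rfl (Fin.cases rfl (Fin.cases rfl fun x => rfl)) x
    · refine Fin.cases rfl (fun x => rfl) x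
  pair_ne := by
    rintro (x | x)
    · refine Fin.cases ?_ (Fin.cases ?_ (Fin.cases ?_ fun x => ?_)) x
      · exact Sum.inr_ne_inl
      · intro h
        have : (2 : ℕ) = 1 := congrArg Fin.val (Sum.inl_injective h)
        omega
      · intro h
        have : (1 : ℕ) = 2 := congrArg Fin.val (Sum.inl_injective h)
        omega
      · exact Sum.inr_ne_inl
    · refine Fin.cases ?_ (fun x => ?_) x
      · exact Sum.inl_ne_inr
      · exact Sum.inl_ne_inr

/-- The middle dot `0` goes up at once, the dot `1` reaches it through the cup, and all further
middle dots go straight down. -/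
theorem noLoop_straightener (p : ℕ) : NoLoop (straightener p) (addCup (p + 1)) := by
  refine Fin.cases ?_ (Fin.cases ?_ fun x => ?_)
  · exact ⟨Sum.inr 0, joined_upper (straightener p) (addCup (p + 1)) (Sum.inl 0)⟩
  · exact ⟨Sum.inr 0, (joined_lower (straightener p) (addCup (p + 1)) (Sum.inr 1)).trans
      (joined_upper (straightener p) (addCup (p + 1)) (Sum.inl 0))⟩
  · exact ⟨Sum.inl x, joined_lower (straightener p) (addCup (p + 1)) (Sum.inr x.succ.succ)⟩

/-- The zigzag starts at the lower dot `0` and passes through the middle dots `2`, `1`, `0` (by the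
cap, then the cup) to the upper dot `0`; the other lines are vertical. It uses up one propagating
line, which is why the object is `p + 1` and not `p`. -/
theorem stack_straightener (p : ℕ) :
    stack (straightener p) (addCup (p + 1)) = idDiagram (p + 1) := by
  have key : ∀ x : Fin (p + 1), Joined (straightener p) (addCup (p + 1))
      (outerDot _ (Sum.inl x)) (outerDot _ (Sum.inr x)) := by
    refine Fin.cases ?_ fun x => ?_
    · exact (((joined_lower (straightener p) (addCup (p + 1)) (Sum.inl 0)).upper
        (Sum.inl 2)).lower (Sum.inr 1)).upper (Sum.inl 0)
    · exact (joined_lower (straightener p) (addCup (p + 1)) (Sum.inl x.succ)).upper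
        (Sum.inl x.succ.succ.succ)
  refine stack_eq_of_joined _ _ _ ?_
  rintro (x | x)
  · exact key x
  · exact (key x).symm

/-- Open the cup of `d` that joins the upper dots `a` and `b`, and connect its ends to two new
lower dots. -/
def openCup (d : Diagram 0 n) (a b : Fin n) (h : d.pair (Sum.inr a) = Sum.inr b) :
    Diagram 2 n where
  -- The new lower dots `0` and `1` are attached to `a` and `b`. All other partners are upper dots
  -- because `d` has no lower ones, so the `Fin.elim0` branch is vacuous.
  pair := Sum.elim ![Sum.inr a, Sum.inr b] fun z =>
    if z = a then Sum.inl 0 else if z = b then Sum.inl 1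
    else Sum.map Fin.elim0 id (d.pair (Sum.inr z))
  pair_pair := by
    have hab : b ≠ a := fun e => d.pair_ne (Sum.inr a) (by rw [h, e])
    have h' : d.pair (Sum.inr b) = Sum.inr a := by rw [← h, d.pair_pair]
    rintro (x | z)
    · fin_cases x
      · simp
      · simp [hab]
    · by_cases ha : z = a
      · simp [ha]
      by_cases hb : z = b
      · simp [hb, hab]
      rcases e : d.pair (Sum.inr z) with y | y
      · exact y.elim0
      have e' : d.pair (Sum.inr y) = Sum.inr z := by rw [← e, d.pair_pair]
      have ha' : y ≠ a := by
        rintro rfl; rw [h] at e'; exact hb (Sum.inr_injective e').symm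
      have hb' : y ≠ b := by
        rintro rfl; rw [h'] at e'; exact ha (Sum.inr_injective e').symm
      simp [ha, hb, e, e', ha', hb']
  pair_ne := by
    rintro (x | z)
    · fin_cases x <;> simp
    · by_cases ha : z = a
      · simp [ha]
      by_cases hb : z = b
      · have hab : b ≠ a := fun e => ha (hb.trans e)
        simp [hb, hab]
      rcases e : d.pair (Sum.inr z) with y | y
      · exact y.elim0
      have := d.pair_ne (Sum.inr z)
      rw [e] at this
      simpa [ha, hb, e] using this

theorem noCap_openCup (d : Diagram 0 n) (a b : Fin n) (h : d.pair (Sum.inr a) = Sum.inr b) :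
    NoCap (openCup d a b h) ![a, b] := by
  intro x
  fin_cases x <;> rfl

/-- This serves `factors_through_cup`, where the cup on the dots `0`, `1` has to survive when the
one on `2`, `3` is opened. -/
theorem openCup_pair_of_ne (d : Diagram 0 n) (a b : Fin n) (h : d.pair (Sum.inr a) = Sum.inr b)
    {x y : Fin n} (hxy : d.pair (Sum.inr x) = Sum.inr y) (ha : x ≠ a) (hb : x ≠ b) :
    (openCup d a b h).pair (Sum.inr x) = Sum.inr y := by
  simp [openCup, ha, hb, hxy]

/-- The cup placed below joins the two new ends again. Hence any diagram without lower dots factors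
through the cup at each of its own cups. -/
theorem stack_openCup (d : Diagram 0 n) (a b : Fin n) (h : d.pair (Sum.inr a) = Sum.inr b) :
    stack (openCup d a b h) (addCup 0) = d := by
  have h' : d.pair (Sum.inr b) = Sum.inr a := by rw [← h, d.pair_pair]
  refine (noCap_openCup d a b h).stack_eq ?_ ?_
  · rintro (x | x)
    · exact x.elim0
    · fin_cases x
      · exact h
      · exact h'
  · intro x y hxy
    by_cases ha : x = a
    · simp [openCup, ha] at hxy
    by_cases hb : x = b
    · have hab : b ≠ a := fun e => d.pair_ne (Sum.inr a) (by rw [h, e])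
      simp [openCup, hb, hab] at hxy
    rcases e : d.pair (Sum.inr x) with z | z
    · exact z.elim0
    · simpa [openCup, ha, hb, e] using hxy

/-- A diagram with two upper dots that are joined by a cup is a cup stacked onto a diagram without
upper dots. -/
theorem exists_stack_cup (d : Diagram j 2) (h : d.pair (Sum.inr 0) = Sum.inr 1) :
    ∃ d' : Diagram j 0, stack (addCup 0) d' = d := by
  have h' : d.pair (Sum.inr 1) = Sum.inr 0 := by rw [← h, d.pair_pair]
  -- The only two upper dots are taken by the cup, so each lower dot lies on a cap; these caps form
  -- the diagram `d'`.
  have hl : ∀ x, ∃ y, d.pair (Sum.inl x) = Sum.inl y := by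
    intro x
    rcases e : d.pair (Sum.inl x) with y | y
    · exact ⟨y, rfl⟩
    · have e' := congrArg d.pair e
      rw [d.pair_pair] at e'
      fin_cases y
      · exact absurd (e'.trans h) Sum.inl_ne_inr
      · exact absurd (e'.trans h') Sum.inl_ne_inr
  choose g hg using hl
  refine ⟨⟨Sum.elim (Sum.inl ∘ g) Fin.elim0, ?_, ?_⟩, (noCap_addCup 0).stack_eq ?_ ?_⟩
  · rintro (x | x)
    · have := d.pair_pair (Sum.inl x)
      rw [hg, hg] at this
      exact congrArg Sum.inl (Sum.inl_injective this)
    · exact x.elim0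
  · rintro (x | x)
    · have := d.pair_ne (Sum.inl x)
      rw [hg] at this
      exact fun e => this (congrArg Sum.inl (Sum.inl_injective e))
    · exact x.elim0
  · rintro (x | x)
    · exact hg x
    · exact x.elim0
  · intro a b hab
    fin_cases a
    · have : (1 : Fin 2) = b := Sum.inr_injective hab
      exact this ▸ h
    · have : (0 : Fin 2) = b := Sum.inr_injective hab
      exact this ▸ h'

/-! ### Morphisms of the category -/

variable {𝕜 : Type u} [Field 𝕜]

/-- A diagram as a basis element of the space of morphisms. -/
noncomputable def Diagram.hom (𝕜 : Type u) [Field 𝕜] (d : Diagram i j) :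
    (⟨i⟩ : BrauerCategory 𝕜) ⟶ ⟨j⟩ :=
  (Finsupp.single d 1 : Diagram i j →₀ 𝕜)

-- Linear induction on finitely supported functions, phrased with the operations of the category so
-- that the lemmas on `≫` apply to each case.
@[elab_as_elim]
theorem hom_induction {p : ((⟨i⟩ : BrauerCategory 𝕜) ⟶ ⟨j⟩) → Prop}
    (c : (⟨i⟩ : BrauerCategory 𝕜) ⟶ ⟨j⟩) (h0 : p 0) (hadd : ∀ c c', p c → p c' → p (c + c'))
    (hsmul : ∀ (r : 𝕜) (d : Diagram i j), p (r • d.hom 𝕜)) : p c := by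
  refine Finsupp.induction_linear (motive := p) c h0 hadd fun d r => ?_
  have := hsmul r d
  rwa [show r • d.hom 𝕜 = (Finsupp.single d r : Diagram i j →₀ 𝕜) from
    Finsupp.smul_single_one d r] at this

theorem hom_comp (d₁ : Diagram j k) (d₂ : Diagram i j) (h : NoLoop d₁ d₂) :
    d₂.hom 𝕜 ≫ d₁.hom 𝕜 = (sign d₁ d₂ : 𝕜) • (stack d₁ d₂).hom 𝕜 := by
  change compBilin 𝕜 (Finsupp.single d₁ 1) (Finsupp.single d₂ 1) =
    (sign d₁ d₂ : 𝕜) • (Finsupp.single (stack d₁ d₂) 1 : Diagram i k →₀ 𝕜)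
  rw [compBilin_single, diagramComp, if_pos h]
  simp

/-- This is all that the argument uses about signs: a sign is its own inverse, so it can be moved to
the other side of an equation, as in `smul_comp_hom`. -/
theorem sign_mul_self (d₁ : Diagram j k) (d₂ : Diagram i j) :
    (sign d₁ d₂ : 𝕜) * (sign d₁ d₂ : 𝕜) = 1 := by
  rcases sign_eq_or d₁ d₂ with h | h <;> simp [h]

theorem sign_ne_zero (d₁ : Diagram j k) (d₂ : Diagram i j) : (sign d₁ d₂ : 𝕜) ≠ 0 :=
  left_ne_zero_of_mul_eq_one (sign_mul_self d₁ d₂)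

theorem smul_comp_hom (d₁ : Diagram j k) (d₂ : Diagram i j) (h : NoLoop d₁ d₂) :
    (sign d₁ d₂ : 𝕜) • (d₂.hom 𝕜 ≫ d₁.hom 𝕜) = (stack d₁ d₂).hom 𝕜 := by
  rw [hom_comp _ _ h, smul_smul, sign_mul_self, one_smul]

/-! ### Coefficients of composites with a diagram without caps -/

/-- The coefficient of a diagram in a morphism. -/
noncomputable def coeff (d : Diagram i j) : ((⟨i⟩ : BrauerCategory 𝕜) ⟶ ⟨j⟩) →ₗ[𝕜] 𝕜 :=
  (Finsupp.lapply d : (Diagram i j →₀ 𝕜) →ₗ[𝕜] 𝕜)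

open Classical in
theorem coeff_hom (d d' : Diagram i j) : coeff d (d'.hom 𝕜) = if d' = d then 1 else 0 :=
  Finsupp.single_apply

theorem ext_coeff {c c' : (⟨i⟩ : BrauerCategory 𝕜) ⟶ ⟨j⟩} (h : ∀ d, coeff d c = coeff d c') :
    c = c' := Finsupp.ext (f := (c : Diagram i j →₀ 𝕜)) (g := c') h

/-- By `NoCap.stack_injective`, `d` is the only diagram in `c` that contributes to this coefficient.
-/
theorem coeff_comp_noCap {u : Diagram j k} {f : Fin j → Fin k} (hu : NoCap u f)
    (d : Diagram i j) (c : (⟨i⟩ : BrauerCategory 𝕜) ⟶ ⟨j⟩) :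
    coeff (stack u d) (c ≫ u.hom 𝕜) = (sign u d : 𝕜) * coeff d c := by
  induction c using hom_induction with
  | h0 => simp
  | hadd c c' h h' => rw [Preadditive.add_comp, map_add, map_add, h, h', mul_add]
  | hsmul r d' =>
    rw [Linear.smul_comp, hom_comp _ _ (hu.noLoop d'), map_smul, map_smul, map_smul, coeff_hom,
      coeff_hom]
    by_cases e : d' = d
    · subst e; simp [mul_comm]
    · rw [if_neg e, if_neg fun h => e (hu.stack_injective h)]; simp

/-- Counterpart of `coeff_comp_noCap`: composition with `u` produces only diagrams of the form
`stack u d'`. -/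
theorem coeff_comp_eq_zero {u : Diagram j k} {f : Fin j → Fin k} (hu : NoCap u f)
    {d : Diagram i k} (hd : ∀ d', stack u d' ≠ d) (c : (⟨i⟩ : BrauerCategory 𝕜) ⟶ ⟨j⟩) :
    coeff d (c ≫ u.hom 𝕜) = 0 := by
  induction c using hom_induction with
  | h0 => simp
  | hadd c c' h h' => rw [Preadditive.add_comp, map_add, h, h', add_zero]
  | hsmul r d' =>
    rw [Linear.smul_comp, hom_comp _ _ (hu.noLoop d'), map_smul, map_smul, coeff_hom,
      if_neg (hd d')]
    simp

/-- Stacking a diagram without caps onto morphisms is injective. -/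
theorem eq_zero_of_comp_noCap {u : Diagram j k} {f : Fin j → Fin k} (hu : NoCap u f)
    {c : (⟨i⟩ : BrauerCategory 𝕜) ⟶ ⟨j⟩} (h : c ≫ u.hom 𝕜 = 0) : c = 0 := by
  refine ext_coeff fun d => ?_
  have := coeff_comp_noCap hu d c
  rw [h, map_zero] at this
  rw [map_zero]
  exact (mul_eq_zero.1 this.symm).resolve_left (sign_ne_zero u d)

/-! ### Retracts and factorisation through the cup -/

/-- A non-zero object is a retract of every larger object of the same parity. -/
theorem exists_retract (𝕜 : Type u) [Field 𝕜] (p m : ℕ) :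
    ∃ (s : (⟨p + 1⟩ : BrauerCategory 𝕜) ⟶ ⟨p + 2 * m + 1⟩)
      (r : (⟨p + 2 * m + 1⟩ : BrauerCategory 𝕜) ⟶ ⟨p + 1⟩), s ≫ r = 𝟙 _ := by
  induction m with
  | zero => exact ⟨𝟙 _, 𝟙 _, Category.comp_id _⟩
  | succ m ih =>
    obtain ⟨s, r, h⟩ := ih
    -- The larger object is rewritten, by definitional equality, as the target of `addCup`.
    change ∃ (s : (⟨p + 1⟩ : BrauerCategory 𝕜) ⟶ ⟨p + 2 * m + 1 + 2⟩)
      (r : (⟨p + 2 * m + 1 + 2⟩ : BrauerCategory 𝕜) ⟶ ⟨p + 1⟩), s ≫ r = 𝟙 _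
    -- One more cup after `s` and one straightening cap before `r`; the scalar cancels the sign of
    -- the zigzag.
    refine ⟨s ≫ (addCup (p + 2 * m + 1)).hom 𝕜,
      (sign (straightener (p + 2 * m)) (addCup (p + 2 * m + 1)) : 𝕜) •
        (straightener (p + 2 * m)).hom 𝕜 ≫ r, ?_⟩
    rw [Category.assoc, Linear.comp_smul, ← Category.assoc ((addCup _).hom 𝕜), ← Linear.smul_comp,
      smul_comp_hom _ _ (noLoop_straightener _), stack_straightener,
      show (idDiagram (p + 2 * m + 1)).hom 𝕜 = 𝟙 _ from rfl, Category.id_comp, h]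

/-- A morphism to the object `2` that is killed by all morphisms to `4` that kill the cup factors
through the cup. -/
theorem factors_through_cup (c : (⟨j⟩ : BrauerCategory 𝕜) ⟶ ⟨2⟩)
    (h : ∀ b : (⟨2⟩ : BrauerCategory 𝕜) ⟶ ⟨4⟩, (addCup 0).hom 𝕜 ≫ b = 0 → c ≫ b = 0) :
    ∃ c' : (⟨j⟩ : BrauerCategory 𝕜) ⟶ ⟨0⟩, c = c' ≫ (addCup 0).hom 𝕜 := by
  -- `D` consists of two cups side by side. Opening the left one gives `b₁` and opening the right
  -- one gives `b₂`.
  have hD : ∃ D : Diagram 0 4, D.pair (Sum.inr 0) = Sum.inr 1 ∧ D.pair (Sum.inr 2) = Sum.inr 3 :=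
    ⟨stack (addCup 2) (addCup 0), stack_pair_of_cup rfl _,
      (noCap_addCup 2).stack_pair (addCup 0) (Sum.inr 0)⟩
  obtain ⟨D, h01, h23⟩ := hD
  have hb₁ := noCap_openCup D _ _ h01
  have hb₂ := noCap_openCup D _ _ h23
  have hcup : (openCup D _ _ h23).pair (Sum.inr 0) = Sum.inr 1 :=
    openCup_pair_of_ne D _ _ h23 h01 (by decide) (by decide)
  have e₁ := smul_comp_hom (𝕜 := 𝕜) _ _ (hb₁.noLoop (addCup 0))
  have e₂ := smul_comp_hom (𝕜 := 𝕜) _ _ (hb₂.noLoop (addCup 0))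
  rw [stack_openCup] at e₁ e₂
  set b₁ := openCup D _ _ h01
  set b₂ := openCup D _ _ h23
  -- The test morphism: composed with the cup, both terms close up to the same `D`, and the signs
  -- make them cancel.
  have hc := h ((sign b₁ (addCup 0) : 𝕜) • b₁.hom 𝕜 - (sign b₂ (addCup 0) : 𝕜) • b₂.hom 𝕜) (by
    rw [Preadditive.comp_sub, Linear.comp_smul, Linear.comp_smul, e₁, e₂, sub_self])
  rw [Preadditive.comp_sub, Linear.comp_smul, Linear.comp_smul] at hc
  -- The term through `b₂` contains only diagrams that join the upper dots `0` and `1`. If `d` does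
  -- not join its two upper dots, `stack b₁ d` does not join `0` and `1` either, so its coefficient
  -- comes from `b₁` alone and equals that of `d` in `c` up to signs.
  have hcoeff : ∀ d : Diagram j 2, d.pair (Sum.inr 0) ≠ Sum.inr 1 → coeff d c = 0 := by
    intro d hd
    have h1 := congrArg (coeff (stack b₁ d)) hc
    rw [map_sub, map_smul, map_smul, coeff_comp_noCap hb₁, coeff_comp_eq_zero hb₂, map_zero,
      smul_zero, sub_zero, smul_eq_mul] at h1
    · exact (mul_eq_zero.1 ((mul_eq_zero.1 h1).resolve_left (sign_ne_zero _ _))).resolve_left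
        (sign_ne_zero _ _)
    · intro d' e
      have h2 := stack_pair_of_cup hcup d'
      rw [e] at h2
      have h3 := hb₁.stack_pair d (Sum.inr 0)
      have h4 : Sum.map id ![(0 : Fin 4), 1] (d.pair (Sum.inr 0)) =
        Sum.map id ![(0 : Fin 4), 1] (Sum.inr 1) := h3.symm.trans h2
      exact hd (Sum.map_injective.2 ⟨Function.injective_id, hb₁.injective⟩ h4)
  have hsum : c = Finsupp.sum (c : Diagram j 2 →₀ 𝕜) fun d r => r • d.hom 𝕜 := by
    conv_lhs => rw [← Finsupp.sum_single (c : Diagram j 2 →₀ 𝕜)]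
    exact Finsupp.sum_congr fun d _ => (Finsupp.smul_single_one d _).symm
  -- The morphisms that factor through the cup form a subspace, so it suffices to treat the diagrams
  -- in the support of `c`; by `hcoeff` all of them contain the cup.
  have hmem : c ∈ LinearMap.range
      (Linear.rightComp 𝕜 (⟨j⟩ : BrauerCategory 𝕜) ((addCup 0).hom 𝕜)) := by
    rw [hsum]
    refine Submodule.sum_mem _ fun d hd => ?_
    have hd' : d.pair (Sum.inr 0) = Sum.inr 1 := by
      by_contra e
      exact (Finsupp.mem_support_iff.1 hd) (hcoeff d e)
    obtain ⟨d', rfl⟩ := exists_stack_cup d hd'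
    refine Submodule.smul_mem _ _ ⟨(sign (addCup 0) d' : 𝕜) • d'.hom 𝕜, ?_⟩
    rw [Linear.rightComp_apply, Linear.smul_comp, smul_comp_hom _ _ ((noCap_addCup 0).noLoop d')]
  obtain ⟨c', hc'⟩ := hmem
  exact ⟨c', hc'.symm⟩

/-- Every morphism from `0` to a non-zero object factors through the cup. -/
theorem exists_cup_comp (x : (⟨0⟩ : BrauerCategory 𝕜) ⟶ ⟨n⟩) (hn : 0 < n) :
    ∃ y : (⟨2⟩ : BrauerCategory 𝕜) ⟶ ⟨n⟩, x = (addCup 0).hom 𝕜 ≫ y := by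
  induction x using hom_induction with
  | h0 => exact ⟨0, by simp⟩
  | hadd _ _ h h' =>
    obtain ⟨y, rfl⟩ := h
    obtain ⟨y', rfl⟩ := h'
    exact ⟨y + y', (Preadditive.comp_add _ _ _ _ _ _).symm⟩
  | hsmul r d =>
    -- Without lower dots, the first upper dot lies on a cup, and this is the cup to open.
    rcases e : d.pair (Sum.inr ⟨0, hn⟩) with z | z
    · exact z.elim0
    · refine ⟨r • (sign (openCup d _ _ e) (addCup 0) : 𝕜) • (openCup d _ _ e).hom 𝕜, ?_⟩
      rw [Linear.comp_smul, Linear.comp_smul,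
        smul_comp_hom _ _ ((noCap_openCup d _ _ e).noLoop (addCup 0)), stack_openCup]

/-! ### Maps between spaces of morphisms to `n` that commute with the action of `A n` -/

/-- `exists_retract` in the parameters of `mem_J_iff`, with `i = p + 1` and `n = p + 2 * m + 1`. -/
theorem exists_retract_of_pos (𝕜 : Type u) [Field 𝕜] (hi : 0 < i) (hin : i ≤ n)
    (hp : 2 ∣ n - i) :
    ∃ (s : (⟨i⟩ : BrauerCategory 𝕜) ⟶ ⟨n⟩) (r : (⟨n⟩ : BrauerCategory 𝕜) ⟶ ⟨i⟩),
      s ≫ r = 𝟙 _ := by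
  obtain ⟨m, hm⟩ := hp
  obtain ⟨p, rfl⟩ : ∃ p, i = p + 1 := ⟨i - 1, by omega⟩
  obtain rfl : n = p + 2 * m + 1 := by omega
  exact exists_retract 𝕜 p m

theorem mem_J_iff : i ∈ J n ↔ i ≤ n ∧ 2 ∣ n - i := by
  simp only [J, Finset.mem_image, Finset.mem_range]
  constructor
  · rintro ⟨a, h, rfl⟩; omega
  · rintro ⟨h, m, hm⟩; exact ⟨m, by omega, by omega⟩

/-- A map between spaces of morphisms to `n` that commutes with composition with endomorphisms of
`n` is composition with a morphism. -/
theorem exists_eq_comp (hn : 2 < n) (hi : i ∈ J n)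
    (F : ((⟨i⟩ : BrauerCategory 𝕜) ⟶ ⟨n⟩) → ((⟨j⟩ : BrauerCategory 𝕜) ⟶ ⟨n⟩))
    (hF0 : F 0 = 0) (hF : ∀ x (a : (⟨n⟩ : BrauerCategory 𝕜) ⟶ ⟨n⟩), F (x ≫ a) = F x ≫ a) :
    ∃ c : (⟨j⟩ : BrauerCategory 𝕜) ⟶ ⟨i⟩, ∀ x, F x = c ≫ x := by
  obtain ⟨hin, hdvd⟩ := mem_J_iff.1 hi
  rcases Nat.eq_zero_or_pos i with rfl | hpos
  -- With `0` in `J n` the number `n` is even, and `2 < n` then gives `4 ≤ n`: this is what the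
  -- retract `4` below requires.
  · obtain ⟨s₂, r₂, h₂⟩ := exists_retract_of_pos (i := 2) (n := n) 𝕜 (by omega) (by omega)
      (by omega)
    obtain ⟨s₄, r₄, h₄⟩ := exists_retract_of_pos (i := 4) (n := n) 𝕜 (by omega) (by omega)
      (by omega)
    -- The retract argument at the object `2`: insert `s₂ ≫ r₂` before `y` and pull the endomorphism
    -- `r₂ ≫ y` of `n` out of `F`.
    have key : ∀ y : (⟨2⟩ : BrauerCategory 𝕜) ⟶ ⟨n⟩,
        F ((addCup 0).hom 𝕜 ≫ y) = (F ((addCup 0).hom 𝕜 ≫ s₂) ≫ r₂) ≫ y := by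
      intro y
      rw [Category.assoc, ← hF, Category.assoc, reassoc_of% h₂]
    -- A morphism `b` to `4` becomes an admissible argument of `key` after composition with `s₄`. If
    -- the cup kills `b`, then `hF0` makes the left side vanish, and `r₄` removes `s₄` again.
    obtain ⟨c', hc'⟩ := factors_through_cup (F ((addCup 0).hom 𝕜 ≫ s₂) ≫ r₂) (by
      intro b hb
      have h := key (b ≫ s₄)
      rw [← Category.assoc, hb, Limits.zero_comp, hF0] at h
      have h' := congrArg (fun z => z ≫ r₄) h
      simpa only [Limits.zero_comp, Category.assoc, h₄, Category.comp_id] using h'.symm)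
    refine ⟨c', fun x => ?_⟩
    obtain ⟨y, rfl⟩ := exists_cup_comp x (by omega)
    rw [key, hc', Category.assoc]
  · obtain ⟨s, r, h⟩ := exists_retract_of_pos (n := n) 𝕜 hpos hin hdvd
    -- Here `x = s ≫ (r ≫ x)`, and `r ≫ x` is an endomorphism of `n`.
    refine ⟨F s ≫ r, fun x => ?_⟩
    rw [Category.assoc, ← hF, reassoc_of% h]

/-- Morphisms to an object in `J n` are separated by the morphisms from that object to `n`. -/
theorem eq_zero_of_comp (hn : 2 < n) (hi : i ∈ J n) (c : (⟨j⟩ : BrauerCategory 𝕜) ⟶ ⟨i⟩)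
    (h : ∀ x : (⟨i⟩ : BrauerCategory 𝕜) ⟶ ⟨n⟩, c ≫ x = 0) : c = 0 := by
  obtain ⟨hin, hdvd⟩ := mem_J_iff.1 hi
  have of_retract : ∀ {k : ℕ} (c : (⟨j⟩ : BrauerCategory 𝕜) ⟶ ⟨k⟩), 0 < k → k ≤ n → 2 ∣ n - k →
      (∀ x : (⟨k⟩ : BrauerCategory 𝕜) ⟶ ⟨n⟩, c ≫ x = 0) → c = 0 := by
    intro k c h1 h2 h3 h
    obtain ⟨s, r, e⟩ := exists_retract_of_pos (n := n) 𝕜 h1 h2 h3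
    rw [← Category.comp_id c, ← e, ← Category.assoc, h, Limits.zero_comp]
  rcases Nat.eq_zero_or_pos i with rfl | hpos
  -- The object `0` is replaced by `2`: composition with the cup loses nothing, and `2` is a retract
  -- of `n`.
  · refine eq_zero_of_comp_noCap (noCap_addCup 0) (of_retract _ (by omega) (by omega) (by omega)
      fun x => ?_)
    rw [Category.assoc, h]
  · exact of_retract c hpos hin hdvd h

/-! ### The two actions on `X` -/

/-- The object `n` as an element of `J n`. -/
abbrev top (n : ℕ) : J n := ⟨n, self_mem_J n⟩

theorem corner_mul_apply_of_ne (a : A 𝕜 n) (c : C 𝕜 n) (i : J n) {l : J n} (h : l ≠ top n) :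
    (corner a * c) i l = 0 := by
  rw [C.mul_apply]
  exact Finset.sum_eq_zero fun r _ => by rw [corner_apply_of_ne' _ _ _ h, Limits.comp_zero]

/-- The component of an element of `X` at `i`, a morphism from `i` to `n`. -/
def component (x : X 𝕜 n) (i : J n) : (⟨i⟩ : BrauerCategory 𝕜) ⟶ ⟨n⟩ := (x : C 𝕜 n) i (top n)

theorem component_corner_mul (a : A 𝕜 n) (c : C 𝕜 n) (i : J n) :
    component ⟨corner a * c, corner_mul_mem a⟩ i =
      CategoryStruct.comp (Z := ⟨n⟩) (c i (top n)) a := by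
  change ∑ r, c i r ≫ corner a r (top n) = _
  rw [Finset.sum_eq_single (top n)]
  · rw [corner_apply]
  · intro r _ h
    rw [corner_apply_of_ne _ _ _ h, Limits.comp_zero]
  · simp

/-- Left multiplication by `eStar` keeps only the morphisms with target `n`. With `X_ext` and
`exists_component_eq` this identifies `X` with the product of the spaces of morphisms from the
objects of `J n` to `n`. -/
theorem apply_of_mem_X (x : X 𝕜 n) (i : J n) {l : J n} (h : l ≠ top n) : (x : C 𝕜 n) i l = 0 := by
  rw [← e_mul_of_mem x.2]
  exact corner_mul_apply_of_ne _ _ _ h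

theorem X_ext {x y : X 𝕜 n} (h : ∀ i, component x i = component y i) : x = y := by
  refine Subtype.ext (C.ext' fun i l => ?_)
  by_cases hl : l = top n
  · subst hl; exact h i
  · rw [apply_of_mem_X x i hl, apply_of_mem_X y i hl]

/-- The family is extended by zero to an element of `C 𝕜 n`; multiplication by the idempotent puts
it into `X` without changing its components. -/
theorem exists_component_eq (f : (i : J n) → ((⟨i⟩ : BrauerCategory 𝕜) ⟶ ⟨n⟩)) :
    ∃ x : X 𝕜 n, ∀ i, component x i = f i := by
  let c : C 𝕜 n := fun i => Pi.single (M := fun j : J n => ((⟨i⟩ : BrauerCategory 𝕜) ⟶ ⟨j⟩))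
    (top n) (f i)
  refine ⟨⟨corner 1 * c, corner_mul_mem 1⟩, fun i => ?_⟩
  rw [component_corner_mul]
  refine (Category.comp_id _).trans ?_
  exact Pi.single_eq_same (M := fun j : J n => ((⟨i⟩ : BrauerCategory 𝕜) ⟶ ⟨j⟩)) (top n) (f i)

/-- The element of `X` with given components. -/
noncomputable def ofComponents (f : (i : J n) → ((⟨i⟩ : BrauerCategory 𝕜) ⟶ ⟨n⟩)) : X 𝕜 n :=
  (exists_component_eq f).choose

theorem component_ofComponents (f : (i : J n) → ((⟨i⟩ : BrauerCategory 𝕜) ⟶ ⟨n⟩)) (i : J n) :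
    component (ofComponents f) i = f i := (exists_component_eq f).choose_spec i

/-- The element of `X` whose only component is the morphism `x` from `i` to `n`. -/
noncomputable def inX (i : J n) (x : (⟨i⟩ : BrauerCategory 𝕜) ⟶ ⟨n⟩) : X 𝕜 n :=
  ofComponents (Pi.single (M := fun i : J n => ((⟨i⟩ : BrauerCategory 𝕜) ⟶ ⟨n⟩)) i x)

theorem inX_same (i : J n) (x : (⟨i⟩ : BrauerCategory 𝕜) ⟶ ⟨n⟩) : component (inX i x) i = x := by
  rw [inX, component_ofComponents, Pi.single_eq_same]

theorem inX_of_ne {i k : J n} (x : (⟨i⟩ : BrauerCategory 𝕜) ⟶ ⟨n⟩) (h : k ≠ i) :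
    component (inX i x) k = 0 := by
  rw [inX, component_ofComponents, Pi.single_eq_of_ne h]

theorem component_zero (i : J n) : component (0 : X 𝕜 n) i = 0 := rfl

theorem component_smul (a : A 𝕜 n) (x : X 𝕜 n) (i : J n) :
    component (a • x) i = component x i ≫ a :=
  component_corner_mul a x i

theorem component_sum {ι : Type*} (s : Finset ι) (f : ι → X 𝕜 n) (k : J n) :
    component (∑ i ∈ s, f i) k = ∑ i ∈ s, component (f i) k :=
  map_sum (⟨⟨fun x => component x k, rfl⟩, fun _ _ => rfl⟩ :
    X 𝕜 n →+ ((⟨k⟩ : BrauerCategory 𝕜) ⟶ ⟨n⟩)) f s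

theorem component_op_smul (c : C 𝕜 n) (x : X 𝕜 n) (i : J n) :
    component (MulOpposite.op c • x) i = ∑ r, c i r ≫ component x r := rfl

theorem inX_zero (i : J n) : inX i (0 : (⟨i⟩ : BrauerCategory 𝕜) ⟶ ⟨n⟩) = 0 := by
  refine X_ext fun k => ?_
  rw [inX, component_ofComponents, Pi.single_zero]
  rfl

/-- Each inclusion `inX i` respects the action of `A 𝕜 n`, so the entries of an `A 𝕜 n`-linear
endomorphism satisfy the hypothesis `hF` of `exists_eq_comp`. -/
theorem inX_comp (i : J n) (x : (⟨i⟩ : BrauerCategory 𝕜) ⟶ ⟨n⟩) (a : A 𝕜 n) :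
    inX i (x ≫ a) = a • inX i x := by
  refine X_ext fun k => ?_
  rw [component_smul]
  by_cases h : k = i
  · subst h; exact (inX_same _ _).trans (congrArg (· ≫ a) (inX_same _ _).symm)
  · rw [inX_of_ne _ h, inX_of_ne _ h]
    exact Limits.zero_comp.symm

theorem sum_inX (x : X 𝕜 n) : ∑ i, inX i (component x i) = x := by
  refine X_ext fun k => ?_
  rw [component_sum, Finset.sum_eq_single k]
  · exact inX_same _ _
  · intro i _ h; exact inX_of_ne _ h.symm
  · simp

/-- As a matrix of maps between the summands of `X`, right multiplication by `c` has precompositions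
with the components of `c` as its entries. -/
theorem component_op_smul_inX (c : C 𝕜 n) (i k : J n) (x : (⟨i⟩ : BrauerCategory 𝕜) ⟶ ⟨n⟩) :
    component (MulOpposite.op c • inX i x) k = c k i ≫ x := by
  rw [component_op_smul, Finset.sum_eq_single i]
  · exact congrArg (c k i ≫ ·) (inX_same i x)
  · intro r _ h
    rw [inX_of_ne _ h]
    exact Limits.comp_zero
  · simp

/-! ### The double centraliser property -/

/-- As a right module `X` is generated by the idempotent, which is `inX (top n) 1`. An endomorphism
is determined by the image of this generator, and only the component of that image at `n` plays a
role. -/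
theorem lsmul_A_bijective (𝕜 : Type u) [Field 𝕜] (n : ℕ) : Function.Bijective
    (Algebra.lsmul 𝕜 (C 𝕜 n)ᵐᵒᵖ (X 𝕜 n) : A 𝕜 n →ₐ[𝕜] Module.End (C 𝕜 n)ᵐᵒᵖ (X 𝕜 n)) := by
  have op_smul_one : ∀ x : X 𝕜 n, MulOpposite.op (x : C 𝕜 n) • inX (top n) (1 : A 𝕜 n) = x := by
    intro x
    refine X_ext fun k => (component_op_smul_inX _ _ _ _).trans ?_
    exact Category.comp_id _
  constructor
  · intro a b h
    have h1 : component (a • inX (top n) (1 : A 𝕜 n)) (top n) =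
        component (b • inX (top n) (1 : A 𝕜 n)) (top n) :=
      congrArg (fun x => component x (top n)) (LinearMap.congr_fun h (inX (top n) (1 : A 𝕜 n)))
    rw [component_smul, component_smul, inX_same] at h1
    exact (Category.id_comp a).symm.trans (h1.trans (Category.id_comp b))
  · intro f
    refine ⟨component (f (inX (top n) (1 : A 𝕜 n))) (top n),
      LinearMap.ext fun x => X_ext fun k => ?_⟩
    refine (component_smul _ x k).trans ?_
    conv_rhs => rw [← op_smul_one x, map_smul, component_op_smul]
    -- Acting as a scalar, `x` has no component with a target other than `n`, so only the component
    -- of the image of the generator at `n` enters.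
    rw [Finset.sum_eq_single (top n)]
    · rfl
    · intro r _ h
      rw [apply_of_mem_X x k h]
      exact Limits.zero_comp
    · exact fun h => absurd (Finset.mem_univ _) h

/-- With the two rings in this order, the right action of `C 𝕜 n` is by `A 𝕜 n`-linear maps, as
needed for the second `Algebra.lsmul`. -/
instance : SMulCommClass (C 𝕜 n)ᵐᵒᵖ (A 𝕜 n) (X 𝕜 n) := .symm _ _ _

/-- An endomorphism is compared with right multiplication entry by entry: `eq_zero_of_comp` gives
injectivity and `exists_eq_comp` surjectivity. -/
theorem lsmul_C_bijective (𝕜 : Type u) [Field 𝕜] (hn : 2 < n) : Function.Bijective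
    (Algebra.lsmul 𝕜 (A 𝕜 n) (X 𝕜 n) : (C 𝕜 n)ᵐᵒᵖ →ₐ[𝕜] Module.End (A 𝕜 n) (X 𝕜 n)) := by
  constructor
  · rw [injective_iff_map_eq_zero]
    intro c hc
    refine MulOpposite.unop_injective (C.ext' fun k i => eq_zero_of_comp hn i.2 _ fun x => ?_)
    rw [← component_op_smul_inX c.unop i k x]
    exact congrArg (fun y => component y k) (LinearMap.congr_fun hc (inX i x))
  · intro f
    have h : ∀ k i : J n, ∃ c : (⟨k⟩ : BrauerCategory 𝕜) ⟶ ⟨i⟩,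
        ∀ x, component (f (inX i x)) k = c ≫ x := by
      intro k i
      refine exists_eq_comp hn i.2 (fun x => component (f (inX i x)) k) ?_ fun x a => ?_
      · rw [inX_zero, map_zero, component_zero]
      · exact (congrArg (fun y => component (f y) k) (inX_comp i x a)).trans
          ((congrArg (fun y => component y k) (f.map_smul _ _)).trans (component_smul _ _ _))
    -- The morphisms found for the single entries are together an element of `C 𝕜 n`, and `sum_inX`
    -- reassembles the endomorphism from its entries.
    choose c hc using h
    refine ⟨MulOpposite.op (c : C 𝕜 n), LinearMap.ext fun x => X_ext fun k => ?_⟩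
    refine (component_op_smul _ x k).trans ?_
    conv_rhs => rw [← sum_inX x, map_sum, component_sum]
    exact Finset.sum_congr rfl fun i _ => (hc k i _).symm

end PeriplecticBrauer

theorem mainTheorem6 (𝕜 : Type*) [Field 𝕜] [IsAlgClosed 𝕜] (n : ℕ) (hn : 2 < n) :
    (∃ φ : PeriplecticBrauer.A 𝕜 n ≃ₐ[𝕜]
        Module.End (PeriplecticBrauer.C 𝕜 n)ᵐᵒᵖ (PeriplecticBrauer.X 𝕜 n),
      ∀ (a : PeriplecticBrauer.A 𝕜 n) (x : PeriplecticBrauer.X 𝕜 n), φ a x = a • x) ∧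
    (∃ ψ : PeriplecticBrauer.C 𝕜 n ≃ₐ[𝕜]
        (Module.End (PeriplecticBrauer.A 𝕜 n) (PeriplecticBrauer.X 𝕜 n))ᵐᵒᵖ,
      ∀ (c : PeriplecticBrauer.C 𝕜 n) (x : PeriplecticBrauer.X 𝕜 n),
        (ψ c).unop x = MulOpposite.op c • x) :=
  ⟨⟨AlgEquiv.ofBijective _ (PeriplecticBrauer.lsmul_A_bijective 𝕜 n), fun _ _ => rfl⟩,
    -- A right action is a homomorphism from the opposite algebra; `AlgEquiv.opComm` moves the
    -- opposite over to the endomorphism ring.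
    ⟨AlgEquiv.opComm.symm (AlgEquiv.ofBijective _ (PeriplecticBrauer.lsmul_C_bijective 𝕜 hn)),
      fun _ _ => rfl⟩⟩
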